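/- Let $X$ be a proper geodesic metric space with a base point $o$, and let a group $G$ act on $X$ properly (for every compact $K\subseteq X$ the set $\{g\in G: gK\cap K\neq\emptyset\}$ is finite) and by isometries. A closed set $Z\subseteq X$ is called contracting if there is $C>0$ such that for all $x,y\in X$ with $d(x,y)\le d(x,Z)$ the set $\pi_Z(x)\cup\pi_Z(y)$ has diameter at most $C$, where $\pi_Z(x)=\{z\in Z: d(x,z)=d(x,Z)\}$. An element $h\in G$ is called contracting if $n\in\mathbb Z\mapsto h^n o$ is a quasi-isometric embedding of $\mathbb Z$ whose image is a contracting set. Assume that $G$ contains a contracting element. Let $E(G)$ denote the maximal finite normal subgroup of $G$. Let $H\le G$ be a confined subgroup with a finite non-degenerate confining subset, that is, suppose there is a finite set $P\subseteq G$ with $P\cap E(G)=\emptyset$ and $g^{-1}Hg\cap (P\setminus\{1\})\ne\emptyset$ for every $g\in G$. For $n\ge 0$ put $B(n)=\{g\in G: d(o,go)\le n\}$ and $B_{G/H}(n)=\{gH\in G/H: d(o,gHo)\le n\}$, and let $\omega_G=\limsup_{n\to\infty}\frac1n\ln|B(n)|\in[0,\infty]$. Then: 1. If $G$ is non-elementary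 (neither finite nor virtually $\mathbb Z$), then $$\frac{|B_{G/H}(n)|}{e^{n\omega_G}}\longrightarrow 0\qquad (n\to\infty),$$ where the quotient is read as $0$ for $n\ge1$ if $\omega_G=\infty$. 2. If the action has purely exponential growth, i.e. $\omega_G<\infty$ and there is $C\ge1$ with $C^{-1}e^{n\omega_G}\le |B(n)|\le C e^{n\omega_G}$ for all $n$, then $H$ has negligible quotient growth: $$\frac{|B_{G/H}(n)|}{|B(n)|}\longrightarrow 0\qquad (n\to\infty).$$ -/

import Mathlib

open Filter Topology
open scoped ENNReal

/-- A metric space is geodesic if any two points are joined by an isometrically embedded segment. -/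
def IsGeodesicSpace (X : Type*) [MetricSpace X] : Prop :=
  ∀ x y : X, ∃ γ : ℝ → X, γ 0 = x ∧ γ (dist x y) = y ∧
    ∀ s ∈ Set.Icc (0 : ℝ) (dist x y), ∀ t ∈ Set.Icc (0 : ℝ) (dist x y),
      dist (γ s) (γ t) = |s - t|

/-- The set `π_Z(x)` of closest points to `x` in `Z`. -/
def closestPoints {X : Type*} [MetricSpace X] (Z : Set X) (x : X) : Set X :=
  {y | y ∈ Z ∧ dist x y = Metric.infDist x Z}

/-- A closed set `Z` is `C`-contracting (`C > 0`) if `d(x, y) ≤ d(x, Z)` implies that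
`π_Z(x) ∪ π_Z(y)` has diameter at most `C`. -/
def IsContractingSet {X : Type*} [MetricSpace X] (C : ℝ) (Z : Set X) : Prop :=
  0 < C ∧ IsClosed Z ∧ ∀ x y : X, dist x y ≤ Metric.infDist x Z →
    ∀ p ∈ closestPoints Z x ∪ closestPoints Z y,
      ∀ q ∈ closestPoints Z x ∪ closestPoints Z y, dist p q ≤ C

/-- `h` is a contracting element (with respect to the base point `o`): the map `n ↦ hⁿ o`, `n ∈ ℤ`,
is a quasi-geodesic (a quasi-isometric embedding of `ℤ`) whose image is a contracting set. -/
def IsContractingElement {G X : Type*} [Group G] [MetricSpace X] [MulAction G X]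
    (o : X) (h : G) : Prop :=
  (∃ c : ℝ, 1 ≤ c ∧ ∀ m n : ℤ,
    |(m : ℝ) - n| / c - c ≤ dist (h ^ m • o) (h ^ n • o) ∧
      dist (h ^ m • o) (h ^ n • o) ≤ c * |(m : ℝ) - n| + c) ∧
  ∃ C : ℝ, IsContractingSet C (Set.range fun n : ℤ => h ^ n • o)

/-- A group is elementary if it is finite or virtually infinite cyclic. -/
def IsElementaryGroup (G : Type*) [Group G] : Prop :=
  Finite G ∨ ∃ K : Subgroup G, K.FiniteIndex ∧ Nonempty (K ≃* Multiplicative ℤ)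

/-- `E(G)`: the subgroup generated by all finite normal subgroups of `G`. It is the maximal finite
normal subgroup of `G` whenever there is one, see `finiteRadical_eq_of_isGreatest`. -/
def finiteRadical (G : Type*) [Group G] : Subgroup G :=
  sSup {N : Subgroup G | N.Normal ∧ Finite N}

theorem finiteRadical_eq_of_isGreatest {G : Type*} [Group G] {E : Subgroup G}
    (hE : IsGreatest {N : Subgroup G | N.Normal ∧ Finite N} E) : finiteRadical G = E :=
  hE.isLUB.sSup_eq

/-- `P` is a finite confining subset for `H`: every conjugate `g⁻¹ H g` meets `P \ {1}`. -/
def IsConfiningSubset {G : Type*} [Group G] (H : Subgroup G) (P : Set G) : Prop :=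
  P.Finite ∧ ∀ g : G, ∃ h ∈ H, g⁻¹ * h * g ∈ P \ {1}

/-- `P` is non-degenerate: it is disjoint from `E(G)`. -/
def IsNondegenerate {G : Type*} [Group G] (P : Set G) : Prop :=
  Disjoint P (finiteRadical G : Set G)

/-- `B(n) = {g ∈ G : d(o, g o) ≤ n}`; a finite set when the action is proper. -/
def orbitBall (G : Type*) {X : Type*} [Group G] [MetricSpace X] [MulAction G X]
    (o : X) (n : ℕ) : Set G :=
  {g | dist o (g • o) ≤ n}

/-- `B_{G/H}(n) = {gH ∈ G/H : d(o, gH o) ≤ n}`; a finite set when the action is proper. -/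
def quotientBall {G X : Type*} [Group G] [MetricSpace X] [MulAction G X]
    (H : Subgroup G) (o : X) (n : ℕ) : Set (G ⧸ H) :=
  {x | Metric.infDist o ((fun g : G => g • o) '' {g : G | (QuotientGroup.mk g : G ⧸ H) = x}) ≤ n}

/-- `ω_G = limsup (1/n) log |B(n)|`, with values in the extended reals. -/
noncomputable def growthRate (G : Type*) {X : Type*} [Group G] [MetricSpace X] [MulAction G X]
    (o : X) : EReal :=
  limsup (fun n : ℕ => ((Real.log ((orbitBall G o n).ncard : ℝ) / (n : ℝ) : ℝ) : EReal)) atTop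

/-- Purely exponential growth: `ω_G` is finite and `|B(n)| ≍ e^{n ω_G}`. -/
def HasPurelyExponentialGrowth (G : Type*) {X : Type*} [Group G] [MetricSpace X] [MulAction G X]
    (o : X) : Prop :=
  ∃ ω : ℝ, growthRate G o = (ω : EReal) ∧ ∃ C : ℝ, 1 ≤ C ∧ ∀ n : ℕ,
    C⁻¹ * Real.exp (n * ω) ≤ ((orbitBall G o n).ncard : ℝ) ∧
      ((orbitBall G o n).ncard : ℝ) ≤ C * Real.exp (n * ω)

/-! ### Geodesics as unit speed maps. -/

section Geometry

variable {X : Type*} [MetricSpace X]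

/-! Write |w| for d(o, wo), fix a contracting h with axis Z = ⟨h⟩o, and let E(h) be
`elementaryClosure h`. Some g lies outside E(h), since otherwise G is virtually cyclic. After one
common conjugation all of P lies outside E(h) (`exists_conj_notMem`, `exists_forall_conj_notMem`).

Represent every coset of H by an inverse of an element w that is shortest in Hw, and let W be the
set of these w. For w in W and v in G insert k p k⁻¹ between w and v, where k is a large power of h.
Corrections from {1, g} make both sides project near o on Z, so a geodesic from o to the product
passes near w and near the prefix ending in k p k⁻¹ (`exists_concatenation`). Confinement allows p
to be chosen, depending on w, so that this prefix is η w up to the bounded correction, with η in H.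
If a much longer w₂ in W gave the same product, a geodesic would run past the prefix before reaching
w₂, and η⁻¹w₂ would be shorter than w₂, a contradiction (`dist_le_of_concatenation_eq`). Hence (w,
v) ↦ product has bounded multiplicity.

For s > ω this gives (Poincaré series of W) · (Poincaré series of G) ≤ const · (Poincaré series of
G). The last factor is finite and cancels, so letting s ↓ ω shows that the series of W converges at
ω. Dominated convergence then gives |W ∩ B(n)| e^{-nω} → 0. This needs ω > 0, which follows by
comparing two growth estimates (`growthRate_pos`). -/

/-- `γ` restricts to a unit speed geodesic on `[0, L]`. -/
def IsGeodesicOn (γ : ℝ → X) (L : ℝ) : Prop :=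
  ∀ s ∈ Set.Icc (0 : ℝ) L, ∀ t ∈ Set.Icc (0 : ℝ) L, dist (γ s) (γ t) = |s - t|

theorem IsGeodesicOn.dist_eq {γ : ℝ → X} {L s t : ℝ} (hγ : IsGeodesicOn γ L) (hs : 0 ≤ s)
    (hst : s ≤ t) (ht : t ≤ L) : dist (γ s) (γ t) = t - s := by
  rw [hγ s ⟨hs, hst.trans ht⟩ t ⟨hs.trans hst, ht⟩, abs_sub_comm, abs_of_nonneg (by linarith)]

theorem IsGeodesicOn.continuousOn {γ : ℝ → X} {L : ℝ} (hγ : IsGeodesicOn γ L) :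
    ContinuousOn γ (Set.Icc 0 L) := by
  refine LipschitzOnWith.continuousOn (K := 1) (LipschitzOnWith.of_dist_le_mul fun s hs t ht => ?_)
  rw [hγ s hs t ht, Real.dist_eq]
  simp

theorem IsGeodesicOn.continuousOn_infDist {γ : ℝ → X} {L : ℝ} (hγ : IsGeodesicOn γ L)
    (Z : Set X) : ContinuousOn (fun r => Metric.infDist (γ r) Z) (Set.Icc 0 L) :=
  (Metric.continuous_infDist_pt Z).comp_continuousOn hγ.continuousOn

theorem le_on_Icc_of_le_on_Ioo {f : ℝ → ℝ} {a b c : ℝ} (hab : a < b)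
    (hf : ContinuousOn f (Set.Icc a b)) (h : ∀ r ∈ Set.Ioo a b, c ≤ f r) :
    ∀ r ∈ Set.Icc a b, c ≤ f r := by
  intro r hr
  rw [← closure_Ioo hab.ne] at hr hf
  exact le_on_closure (f := fun _ => c) h continuousOn_const hf hr

end Geometry

/-! ### Projection of geodesics to a contracting set. -/

section Contracting

variable {X : Type*} [MetricSpace X] {Z : Set X} {C : ℝ}

theorem IsContractingSet.dist_le (hZ : IsContractingSet C Z) {x y p q : X}
    (hxy : dist x y ≤ Metric.infDist x Z) (hp : p ∈ closestPoints Z x)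
    (hq : q ∈ closestPoints Z y) : dist p q ≤ C :=
  hZ.2.2 x y hxy p (Or.inl hp) q (Or.inr hq)

theorem IsContractingSet.dist_le_of_same (hZ : IsContractingSet C Z) {x p q : X}
    (hp : p ∈ closestPoints Z x) (hq : q ∈ closestPoints Z x) : dist p q ≤ C :=
  hZ.dist_le (by rw [dist_self]; exact Metric.infDist_nonneg) hp hq

variable [ProperSpace X]

theorem IsContractingSet.nonempty_closestPoints (hZ : IsContractingSet C Z) (hne : Z.Nonempty)
    (x : X) : (closestPoints Z x).Nonempty := by
  obtain ⟨y, hy, h⟩ := hZ.2.1.exists_infDist_eq_dist hne x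
  exact ⟨y, hy, h.symm⟩

/-- Each step of length 2C along the geodesic moves the projection by at most C, so far from Z the
projection travels at no more than half speed. -/
theorem IsContractingSet.dist_le_mul (hZ : IsContractingSet C Z) (hne : Z.Nonempty)
    {γ : ℝ → X} {L : ℝ} (hγ : IsGeodesicOn γ L) {a : ℝ} (ha : 0 ≤ a) (k : ℕ) :
    ∀ b, a ≤ b → b ≤ L → (∀ r ∈ Set.Icc a b, 2 * C ≤ Metric.infDist (γ r) Z) →
      b - a ≤ 2 * C * (k + 1) → ∀ p ∈ closestPoints Z (γ a), ∀ q ∈ closestPoints Z (γ b),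
      dist p q ≤ C * (k + 1) := by
  have hC := hZ.1
  induction k with
  | zero =>
    intro b hab hb hfar hk p hp q hq
    have h1 := hZ.dist_le (x := γ a) (y := γ b)
      (by rw [hγ.dist_eq ha hab hb]; push_cast at hk; linarith [hfar a ⟨le_rfl, hab⟩]) hp hq
    simpa using h1
  | succ k ih =>
    intro b hab hb hfar hk p hp q hq
    push_cast at hk ⊢
    have h1 : a ≤ max a (b - 2 * C) := le_max_left _ _
    have h2 : max a (b - 2 * C) ≤ b := max_le hab (by linarith)
    obtain ⟨r, hr⟩ := hZ.nonempty_closestPoints hne (γ (max a (b - 2 * C)))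
    have h3 := ih _ h1 (h2.trans hb) (fun r hr => hfar r ⟨hr.1, hr.2.trans h2⟩)
      (by rcases max_cases a (b - 2 * C) with h | h <;> nlinarith [Nat.cast_nonneg (α := ℝ) k])
      p hp r hr
    have h4 : dist r q ≤ C := by
      refine hZ.dist_le ?_ hr hq
      rw [hγ.dist_eq (ha.trans h1) h2 hb]
      linarith [hfar _ ⟨h1, h2⟩, le_max_right a (b - 2 * C)]
    linarith [dist_triangle p r q]

/-- A geodesic that stays away from a contracting set has a short projection. -/
theorem IsContractingSet.dist_le_of_far (hZ : IsContractingSet C Z) (hne : Z.Nonempty)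
    {γ : ℝ → X} {L : ℝ} (hγ : IsGeodesicOn γ L) {a b : ℝ} (ha : 0 ≤ a) (hab : a ≤ b) (hb : b ≤ L)
    (hfar : ∀ r ∈ Set.Icc a b, 2 * C ≤ Metric.infDist (γ r) Z) {p q : X}
    (hp : p ∈ closestPoints Z (γ a)) (hq : q ∈ closestPoints Z (γ b)) : dist p q ≤ 8 * C := by
  have hC := hZ.1
  have hl := hγ.dist_eq ha hab hb
  have hda : 0 ≤ Metric.infDist (γ a) Z := Metric.infDist_nonneg
  have hdb : 0 ≤ Metric.infDist (γ b) Z := Metric.infDist_nonneg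
  set da := Metric.infDist (γ a) Z with hda'
  set db := Metric.infDist (γ b) Z with hdb'
  by_cases h1 : b - a ≤ da
  · linarith [hZ.dist_le (hl.trans_le h1) hp hq]
  push Not at h1
  obtain ⟨r, hr⟩ := hZ.nonempty_closestPoints hne (γ (a + da))
  have hpr : dist p r ≤ C := hZ.dist_le
    (by rw [hγ.dist_eq ha (by linarith) (by linarith)]; linarith) hp hr
  by_cases h2 : b - a ≤ da + db
  · have hrq : dist q r ≤ C := hZ.dist_le
      (by rw [dist_comm, hγ.dist_eq (by linarith) (by linarith) hb]; linarith) hq hr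
    linarith [dist_triangle_right p q r]
  push Not at h2
  obtain ⟨r', hr'⟩ := hZ.nonempty_closestPoints hne (γ (b - db))
  have hqr : dist q r' ≤ C := hZ.dist_le
    (by rw [dist_comm, hγ.dist_eq (by linarith) (by linarith) hb]; linarith) hq hr'
  -- The two end pieces, of lengths da and db, each move the projection by at most C. The middle
  -- piece is no longer than d(p, q), yet its projection moves at half speed, so d(p, q) ≤ d(p, q)/2
  -- + 4C.
  have hlen : b - db - (a + da) ≤ dist p q := by
    have := dist_triangle4 (γ a) p q (γ b)
    rw [hp.2, dist_comm q, hq.2, hl] at this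
    linarith
  have hk := Nat.le_ceil ((b - db - (a + da)) / (2 * C))
  have hk' := (Nat.ceil_lt_add_one
    (div_nonneg (by linarith : 0 ≤ b - db - (a + da)) (by linarith : 0 ≤ 2 * C))).le
  have h3 := hZ.dist_le_mul hne hγ (by linarith : 0 ≤ a + da)
    ⌈(b - db - (a + da)) / (2 * C)⌉₊ (b - db) (by linarith) (by linarith)
    (fun r hr => hfar r ⟨by linarith [hr.1], by linarith [hr.2]⟩)
    (by
      rw [div_le_iff₀ (by linarith)] at hk
      nlinarith) r hr r' hr'
  have h4 : C * ((⌈(b - db - (a + da)) / (2 * C)⌉₊ : ℝ) + 1) ≤ (b - db - (a + da)) / 2 + 2 * C := by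
    have : C * ((b - db - (a + da)) / (2 * C)) = (b - db - (a + da)) / 2 := by field_simp
    nlinarith
  linarith [dist_triangle4 p r r' q, dist_comm q r']

/-- A geodesic whose endpoints have distant projections passes near both projections. -/
theorem IsContractingSet.exists_near (hZ : IsContractingSet C Z) (hne : Z.Nonempty)
    {γ : ℝ → X} {L : ℝ} (hL : 0 ≤ L) (hγ : IsGeodesicOn γ L) {p q : X}
    (hp : p ∈ closestPoints Z (γ 0)) (hq : q ∈ closestPoints Z (γ L)) (hpq : 8 * C < dist p q) :
    ∃ s t, 0 ≤ s ∧ s ≤ t ∧ t ≤ L ∧ dist (γ s) p ≤ 10 * C ∧ dist (γ t) q ≤ 10 * C ∧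
      Metric.infDist (γ s) Z ≤ 2 * C ∧ Metric.infDist (γ t) Z ≤ 2 * C := by
  have hC := hZ.1
  -- Take the first and last times within 2C of Z. Before and after them `dist_le_of_far` costs 8C,
  -- and reaching Z costs another 2C.
  set S : Set ℝ := Set.Icc 0 L ∩ (fun r => Metric.infDist (γ r) Z) ⁻¹' Set.Iic (2 * C) with hS
  have hSc : IsCompact S := isCompact_Icc.of_isClosed_subset
    ((hγ.continuousOn_infDist Z).preimage_isClosed_of_isClosed isClosed_Icc isClosed_Iic)
    Set.inter_subset_left
  have hSne : S.Nonempty := by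
    by_contra h
    refine hpq.not_ge (hZ.dist_le_of_far hne hγ le_rfl hL le_rfl (fun r hr => ?_) hp hq)
    by_contra h'
    push Not at h'
    exact h ⟨r, hr, h'.le⟩
  obtain ⟨s, hs, hmin⟩ := hSc.exists_isLeast hSne
  obtain ⟨t, ht, hmax⟩ := hSc.exists_isGreatest hSne
  refine ⟨s, t, hs.1.1, hmin ht, ht.1.2, ?_, ?_, hs.2, ht.2⟩
  · obtain ⟨r, hr⟩ := hZ.nonempty_closestPoints hne (γ s)
    rcases hs.1.1.eq_or_lt with h0 | h0
    · rw [← h0, hp.2, h0]; exact (hs.2 : Metric.infDist (γ s) Z ≤ 2 * C).trans (by linarith)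
    · have := hZ.dist_le_of_far hne hγ le_rfl hs.1.1 hs.1.2 (le_on_Icc_of_le_on_Ioo h0
        ((hγ.continuousOn_infDist Z).mono (Set.Icc_subset_Icc le_rfl hs.1.2)) (fun r hr => by
          by_contra h'
          push Not at h'
          exact hr.2.not_ge (hmin ⟨⟨hr.1.le, hr.2.le.trans hs.1.2⟩, h'.le⟩))) hp hr
      have h2 : dist (γ s) r ≤ 2 * C := hr.2.trans_le hs.2
      linarith [dist_triangle_right (γ s) p r]
  · obtain ⟨r, hr⟩ := hZ.nonempty_closestPoints hne (γ t)
    rcases ht.1.2.eq_or_lt with h0 | h0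
    · rw [h0, hq.2, ← h0]; exact (ht.2 : Metric.infDist (γ t) Z ≤ 2 * C).trans (by linarith)
    · have := hZ.dist_le_of_far hne hγ ht.1.1 ht.1.2 le_rfl (le_on_Icc_of_le_on_Ioo h0
        ((hγ.continuousOn_infDist Z).mono (Set.Icc_subset_Icc ht.1.1 le_rfl)) (fun r hr => by
          by_contra h'
          push Not at h'
          exact hr.1.not_ge (hmax ⟨⟨ht.1.1.trans hr.1.le, hr.2.le⟩, h'.le⟩))) hr hq
      have h2 : dist (γ t) r ≤ 2 * C := hr.2.trans_le ht.2
      linarith [dist_triangle (γ t) r q]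

/-- An excursion outside the 2C-neighbourhood has endpoints whose projections are 8C-close, so its
length is at most 12C and it stays within 14C of Z. -/
theorem IsContractingSet.infDist_le_of_between (hZ : IsContractingSet C Z) (hne : Z.Nonempty)
    {γ : ℝ → X} {L : ℝ} (hγ : IsGeodesicOn γ L) {s r t : ℝ} (hs0 : 0 ≤ s) (hsr : s ≤ r)
    (hrt : r ≤ t) (htL : t ≤ L) (hs : Metric.infDist (γ s) Z ≤ 2 * C)
    (ht : Metric.infDist (γ t) Z ≤ 2 * C) : Metric.infDist (γ r) Z ≤ 14 * C := by
  have hC := hZ.1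
  by_cases hr : Metric.infDist (γ r) Z ≤ 2 * C
  · linarith
  push Not at hr
  set f := fun r => Metric.infDist (γ r) Z with hf
  have hcont := hγ.continuousOn_infDist Z
  obtain ⟨u, hu, hmax⟩ : ∃ u, IsGreatest (Set.Icc s r ∩ f ⁻¹' Set.Iic (2 * C)) u :=
    (isCompact_Icc.of_isClosed_subset
      ((hcont.mono (Set.Icc_subset_Icc hs0 (hrt.trans htL))).preimage_isClosed_of_isClosed
        isClosed_Icc isClosed_Iic) Set.inter_subset_left).exists_isGreatest ⟨s, ⟨le_rfl, hsr⟩, hs⟩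
  obtain ⟨v, hv, hmin⟩ : ∃ v, IsLeast (Set.Icc r t ∩ f ⁻¹' Set.Iic (2 * C)) v :=
    (isCompact_Icc.of_isClosed_subset
      ((hcont.mono (Set.Icc_subset_Icc (hs0.trans hsr) htL)).preimage_isClosed_of_isClosed
        isClosed_Icc isClosed_Iic) Set.inter_subset_left).exists_isLeast ⟨t, ⟨hrt, le_rfl⟩, ht⟩
  have hu2 : f u ≤ 2 * C := hu.2
  have hv2 : f v ≤ 2 * C := hv.2
  have hur : u < r := hu.1.2.lt_of_ne (fun h => by subst h; exact hr.not_ge hu2)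
  have hrv : r < v := hv.1.1.lt_of_ne (fun h => by subst h; exact hr.not_ge hv2)
  have hu0 : 0 ≤ u := hs0.trans hu.1.1
  have hvL : v ≤ L := hv.1.2.trans htL
  have hfar := le_on_Icc_of_le_on_Ioo (hur.trans hrv)
    (hcont.mono (Set.Icc_subset_Icc hu0 hvL)) (c := 2 * C) (fun x hx => by
      by_contra h'
      push Not at h'
      rcases le_total x r with hxr | hxr
      · exact hx.1.not_ge (hmax ⟨⟨hu.1.1.trans hx.1.le, hxr⟩, h'.le⟩)
      · exact hx.2.not_ge (hmin ⟨⟨hxr, hx.2.le.trans hv.1.2⟩, h'.le⟩))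
  obtain ⟨p, hp⟩ := hZ.nonempty_closestPoints hne (γ u)
  obtain ⟨q, hq⟩ := hZ.nonempty_closestPoints hne (γ v)
  have h1 := hZ.dist_le_of_far hne hγ hu0 (hur.trans hrv).le hvL hfar hp hq
  have h2 := dist_triangle4 (γ u) p q (γ v)
  rw [hp.2, dist_comm q, hq.2, hγ.dist_eq hu0 (hur.trans hrv).le hvL] at h2
  have h3 := Metric.infDist_le_infDist_add_dist (s := Z) (x := γ r) (y := γ u)
  rw [dist_comm, hγ.dist_eq hu0 hur.le (hrv.le.trans hvL)] at h3
  change Metric.infDist (γ u) Z ≤ 2 * C at hu2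
  change Metric.infDist (γ v) Z ≤ 2 * C at hv2
  linarith

theorem IsContractingSet.dist_add_dist_le (hX : IsGeodesicSpace X) (hZ : IsContractingSet C Z)
    (hne : Z.Nonempty) {x y p q : X} (hp : p ∈ closestPoints Z x) (hq : q ∈ closestPoints Z y)
    (hpq : 8 * C < dist p q) : dist x p + dist p y ≤ dist x y + 20 * C := by
  obtain ⟨γ, h0, h1, hγ⟩ := hX x y
  obtain ⟨s, t, hs, hst, ht, hsp, -⟩ := hZ.exists_near hne dist_nonneg hγ (h0.symm ▸ hp)
    (h1.symm ▸ hq) hpq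
  have h2 := IsGeodesicOn.dist_eq hγ le_rfl hs (hst.trans ht)
  have h3 := IsGeodesicOn.dist_eq hγ hs (hst.trans ht) le_rfl
  rw [h0] at h2
  rw [h1] at h3
  linarith [dist_triangle x (γ s) p, dist_triangle_left p y (γ s)]

theorem IsContractingSet.dist_closest_le (hX : IsGeodesicSpace X) (hZ : IsContractingSet C Z)
    (hne : Z.Nonempty) {x y p q : X} (hp : p ∈ closestPoints Z x) (hq : q ∈ closestPoints Z y) :
    dist p q ≤ dist x y + 20 * C := by
  have hC := hZ.1
  by_cases hpq : 8 * C < dist p q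
  · obtain ⟨γ, h0, h1, hγ⟩ := hX x y
    obtain ⟨s, t, hs, hst, ht, hsp, htq, -⟩ := hZ.exists_near hne dist_nonneg hγ (h0.symm ▸ hp)
      (h1.symm ▸ hq) hpq
    have h2 := IsGeodesicOn.dist_eq hγ hs hst ht
    linarith [dist_triangle4 p (γ s) (γ t) q, dist_comm p (γ s)]
  · linarith [dist_nonneg (x := x) (y := y)]

end Contracting

/-! ### The commensurator of a cyclic subgroup. -/

section Elementary

/-- The elements `g` conjugating some nontrivial power of `h` to a power of `h`. -/
def elementaryClosure {G : Type*} [Group G] (h : G) : Subgroup G where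
  carrier := {g | ∃ m n : ℤ, m ≠ 0 ∧ n ≠ 0 ∧ g * h ^ m * g⁻¹ = h ^ n}
  one_mem' := ⟨1, 1, one_ne_zero, one_ne_zero, by simp⟩
  mul_mem' := by
    rintro a b ⟨m, n, hm, hn, e⟩ ⟨m', n', hm', hn', e'⟩
    refine ⟨m' * m, n * n', mul_ne_zero hm' hm, mul_ne_zero hn hn', ?_⟩
    calc a * b * h ^ (m' * m) * (a * b)⁻¹ = a * (b * h ^ m' * b⁻¹) ^ m * a⁻¹ := by
          rw [conj_zpow, zpow_mul]; group
      _ = (a * h ^ m * a⁻¹) ^ n' := by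
          rw [e', conj_zpow, ← zpow_mul, ← zpow_mul, mul_comm n' m]
      _ = h ^ (n * n') := by rw [e, zpow_mul]
  inv_mem' := by
    rintro a ⟨m, n, hm, hn, e⟩
    exact ⟨n, m, hn, hm, by rw [← e]; group⟩

theorem zpow_mem_elementaryClosure {G : Type*} [Group G] (h : G) (n : ℤ) :
    h ^ n ∈ elementaryClosure h :=
  ⟨1, 1, one_ne_zero, one_ne_zero, by group⟩

end Elementary

/-! ### Axes of contracting elements and their projections. -/

section Axis

theorem zpow_smul_mem_axis {G X : Type*} [Group G] [MulAction G X] (h : G) (o : X) (n : ℤ) :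
    h ^ n • o ∈ Set.range fun n : ℤ => h ^ n • o := ⟨n, rfl⟩

/-- A contracting element together with its constants and a choice of closest point projection to
the orbit of the cyclic group it generates. -/
structure ContractingAxis {G X : Type*} [Group G] [MetricSpace X] [MulAction G X]
    (o : X) (h : G) where
  C : ℝ
  c : ℝ
  one_le_c : 1 ≤ c
  le_dist : ∀ m n : ℤ, |(m : ℝ) - n| / c - c ≤ dist (h ^ m • o) (h ^ n • o)
  dist_le : ∀ m n : ℤ, dist (h ^ m • o) (h ^ n • o) ≤ c * |(m : ℝ) - n| + c
  contracting : IsContractingSet C (Set.range fun n : ℤ => h ^ n • o)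
  proj : X → X
  proj_mem : ∀ x, proj x ∈ closestPoints (Set.range fun n : ℤ => h ^ n • o) x

variable {G X : Type*} [Group G] [MetricSpace X] [MulAction G X] {o : X} {h : G}

theorem IsContractingElement.nonempty_contractingAxis [ProperSpace X]
    (hh : IsContractingElement o h) : Nonempty (ContractingAxis o h) := by
  obtain ⟨⟨c, hc, hq⟩, C, hC⟩ := hh
  choose π hπ using hC.nonempty_closestPoints (Set.range_nonempty _)
  exact ⟨⟨C, c, hc, fun m n => (hq m n).1, fun m n => (hq m n).2, hC, π, hπ⟩⟩

theorem finite_setOf_dist_smul_le [ProperSpace X] [ProperlyDiscontinuousSMul G X] (o : X) (R : ℝ) :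
    {g : G | dist o (g • o) ≤ R}.Finite := by
  refine (ProperlyDiscontinuousSMul.finite_disjoint_inter_image (Γ := G)
    (isCompact_singleton (x := o)) (isCompact_closedBall o R)).subset fun g hg => ?_
  refine ⟨g • o, ⟨o, rfl, rfl⟩, ?_⟩
  rw [Metric.mem_closedBall, dist_comm]
  exact hg

theorem infDist_axis_zpow_smul [IsIsometricSMul G X] (n : ℤ) (x : X) :
    Metric.infDist (h ^ n • x) (Set.range fun n : ℤ => h ^ n • o) =
      Metric.infDist x (Set.range fun n : ℤ => h ^ n • o) := by
  have : (fun y : X => h ^ n • y) '' (Set.range fun n : ℤ => h ^ n • o) =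
      Set.range fun n : ℤ => h ^ n • o := by
    ext y
    constructor
    · rintro ⟨_, ⟨k, rfl⟩, rfl⟩
      exact ⟨n + k, by simp only [zpow_add, mul_smul]⟩
    · rintro ⟨k, rfl⟩
      exact ⟨_, ⟨k - n, rfl⟩, by simp only [← mul_smul, ← zpow_add, add_sub_cancel]⟩
  conv_lhs => rw [← this]
  exact Metric.infDist_image (isometry_smul X (h ^ n))

namespace ContractingAxis

variable (A : ContractingAxis o h)
include A

theorem C_pos : 0 < A.C := A.contracting.1

theorem c_pos : 0 < A.c := zero_lt_one.trans_le A.one_le_c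

theorem exists_proj_eq (x : X) : ∃ n : ℤ, A.proj x = h ^ n • o := by
  obtain ⟨n, hn⟩ := (A.proj_mem x).1
  exact ⟨n, hn.symm⟩

theorem proj_zpow_smul (n : ℤ) : A.proj (h ^ n • o) = h ^ n • o := by
  have := (A.proj_mem (h ^ n • o)).2
  rw [Metric.infDist_zero_of_mem (zpow_smul_mem_axis h o n)] at this
  exact (dist_eq_zero.1 this).symm

theorem proj_base : A.proj o = o := by simpa using A.proj_zpow_smul 0

theorem exists_near [ProperSpace X] {γ : ℝ → X} {L : ℝ} {x y : X} (hL : 0 ≤ L)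
    (hγ : IsGeodesicOn γ L) (h0 : γ 0 = x) (h1 : γ L = y)
    (hxy : 8 * A.C < dist (A.proj x) (A.proj y)) :
    ∃ s t, 0 ≤ s ∧ s ≤ t ∧ t ≤ L ∧ dist (γ s) (A.proj x) ≤ 10 * A.C ∧
      dist (γ t) (A.proj y) ≤ 10 * A.C ∧
      Metric.infDist (γ s) (Set.range fun n : ℤ => h ^ n • o) ≤ 2 * A.C ∧
      Metric.infDist (γ t) (Set.range fun n : ℤ => h ^ n • o) ≤ 2 * A.C := by
  subst h0 h1
  exact A.contracting.exists_near (Set.range_nonempty _) hL hγ (A.proj_mem _) (A.proj_mem _) hxy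

theorem proj_lipschitz [ProperSpace X] (hX : IsGeodesicSpace X) (x y : X) :
    dist (A.proj x) (A.proj y) ≤ dist x y + 20 * A.C :=
  A.contracting.dist_closest_le hX (Set.range_nonempty _) (A.proj_mem x) (A.proj_mem y)

theorem exists_lt_dist (T : ℝ) : ∃ N : ℕ, 0 < N ∧ ∀ m n : ℤ, (N : ℤ) ≤ |m - n| →
    T < dist (h ^ m • o) (h ^ n • o) := by
  obtain ⟨N, hN⟩ := exists_nat_gt (A.c * (A.c + T))
  refine ⟨N + 1, N.succ_pos, fun m n hmn => lt_of_lt_of_le ?_ (A.le_dist m n)⟩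
  have h1 : (N : ℝ) + 1 ≤ |(m : ℝ) - n| := by exact_mod_cast hmn
  rw [lt_sub_iff_add_lt, lt_div_iff₀ A.c_pos]
  nlinarith

theorem zpow_injective : Function.Injective fun n : ℤ => h ^ n := by
  intro m n hmn
  by_contra hne
  obtain ⟨N, hN, hd⟩ := A.exists_lt_dist 0
  have h1 : h ^ (m * N) = h ^ (n * N) := by
    simp only at hmn
    rw [zpow_mul, zpow_mul, hmn]
  have h2 := hd (m * N) (n * N) (by
    rw [← sub_mul, abs_mul, Nat.abs_cast]
    have : 1 ≤ |m - n| := Int.one_le_abs (sub_ne_zero.2 hne)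
    nlinarith)
  rw [h1, dist_self] at h2
  exact lt_irrefl _ h2

theorem mem_elementaryClosure {g : G} {m n : ℤ} (hm : m ≠ 0) (e : g * h ^ m * g⁻¹ = h ^ n) :
    g ∈ elementaryClosure h := by
  refine ⟨m, n, hm, ?_, e⟩
  rintro rfl
  rw [zpow_zero, conj_eq_one_iff, ← zpow_zero h] at e
  exact hm (A.zpow_injective e)

variable [IsIsometricSMul G X]

/-- The chosen projection need not be equivariant, but a translated closest point is again a closest
point, and these are C-close. -/
theorem dist_proj_zpow_smul (n : ℤ) (x : X) :
    dist (A.proj (h ^ n • x)) (h ^ n • A.proj x) ≤ A.C := by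
  refine A.contracting.dist_le_of_same (A.proj_mem _) ⟨?_, ?_⟩
  · obtain ⟨k, hk⟩ := A.exists_proj_eq x
    exact ⟨n + k, by simp only [hk, zpow_add, mul_smul]⟩
  · rw [dist_smul, (A.proj_mem x).2, infDist_axis_zpow_smul]

variable [ProperSpace X] (hX : IsGeodesicSpace X)
include hX

/-- If two orbit points of a translate of the axis have distant projections, then the translate
runs close to the axis for a long time. -/
theorem exists_fellow_travel {g : G} {i j : ℤ} (n : ℕ)
    (hij : 20 * A.C + 30 * A.C * n ≤ dist (A.proj (g • h ^ i • o)) (A.proj (g • h ^ j • o))) :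
    ∃ I J : ℕ → ℤ, (∀ k ≤ n, dist (g • h ^ I k • o) (h ^ J k • o) ≤ 28 * A.C) ∧
      ∀ k ≤ n, ∀ l ≤ n, I k = I l → k = l := by
  have hC := A.C_pos
  set Z := Set.range fun n : ℤ => h ^ n • o with hZ
  obtain ⟨γ, h0, h1, hγ⟩ := hX (g • h ^ i • o) (g • h ^ j • o)
  set L := dist (g • h ^ i • o) (g • h ^ j • o)
  have hγ : IsGeodesicOn γ L := hγ
  have hn : (0 : ℝ) ≤ n := n.cast_nonneg
  obtain ⟨s, t, hs, hst, ht, hsp, htq, hsZ, htZ⟩ :=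
    A.exists_near dist_nonneg hγ h0 h1 (by nlinarith)
  have hlen : 30 * A.C * n ≤ t - s := by
    have h2 := hγ.dist_eq hs hst ht
    have := dist_triangle4 (A.proj (g • h ^ i • o)) (γ s) (γ t) (A.proj (g • h ^ j • o))
    rw [dist_comm _ (γ s)] at this
    linarith
  -- Pulled back by g⁻¹, the geodesic has both endpoints on the axis and so stays near it. The
  -- spacing 30C of the samples exceeds 2 · 14C, which forces distinct exponents `I k`.
  set γ' : ℝ → X := fun r => g⁻¹ • γ r with hγ'
  have hgeo' : IsGeodesicOn γ' L := fun a ha b hb => by rw [hγ', dist_smul, hγ a ha b hb]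
  have e0 : γ' 0 = h ^ i • o := by simp [hγ', h0]
  have e1 : γ' L = h ^ j • o := by simp [hγ', h1]
  have hr : ∀ k ≤ n, s ≤ s + 30 * A.C * k ∧ s + 30 * A.C * k ≤ t := by
    intro k hk
    have hk0 : (0 : ℝ) ≤ k := k.cast_nonneg
    have hk' : (k : ℝ) ≤ n := by exact_mod_cast hk
    constructor <;> nlinarith
  have hZ1 : ∀ k ≤ n, dist (γ (s + 30 * A.C * k)) (A.proj (γ (s + 30 * A.C * k))) ≤ 14 * A.C := by
    intro k hk
    rw [(A.proj_mem _).2]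
    exact A.contracting.infDist_le_of_between (Set.range_nonempty _) hγ hs (hr k hk).1 (hr k hk).2
      ht hsZ htZ
  have hZ2 : ∀ k ≤ n, dist (γ' (s + 30 * A.C * k)) (A.proj (γ' (s + 30 * A.C * k))) ≤
      14 * A.C := by
    intro k hk
    rw [(A.proj_mem _).2]
    refine A.contracting.infDist_le_of_between (Set.range_nonempty _) hgeo' le_rfl
      (hs.trans (hr k hk).1) ((hr k hk).2.trans ht) le_rfl ?_ ?_
    · rw [e0, Metric.infDist_zero_of_mem (zpow_smul_mem_axis h o i)]; linarith
    · rw [e1, Metric.infDist_zero_of_mem (zpow_smul_mem_axis h o j)]; linarith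
  choose I hI using fun k : ℕ => A.exists_proj_eq (γ' (s + 30 * A.C * k))
  choose J hJ using fun k : ℕ => A.exists_proj_eq (γ (s + 30 * A.C * k))
  have hgI : ∀ k ≤ n, dist (γ (s + 30 * A.C * k)) (g • h ^ I k • o) ≤ 14 * A.C := by
    intro k hk
    have := hZ2 k hk
    rwa [hI, ← dist_smul g, hγ', smul_inv_smul] at this
  refine ⟨I, J, fun k hk => ?_, fun k hk l hl hkl => ?_⟩
  · have := hZ1 k hk
    rw [hJ] at this
    linarith [dist_triangle_left (g • h ^ I k • o) (h ^ J k • o) (γ (s + 30 * A.C * k)), hgI k hk]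
  · by_contra hne
    have h3 := hgI k hk
    have h4 := hgI l hl
    rw [hkl] at h3
    have h5 := dist_triangle_right (γ (s + 30 * A.C * k)) (γ (s + 30 * A.C * l)) (g • h ^ I l • o)
    rw [hγ _ ⟨hs.trans (hr k hk).1, (hr k hk).2.trans ht⟩ _
      ⟨hs.trans (hr l hl).1, (hr l hl).2.trans ht⟩] at h5
    have h6 : (1 : ℝ) ≤ |(k : ℝ) - l| := by
      have : (1 : ℤ) ≤ |(k : ℤ) - l| := Int.one_le_abs (by omega)
      exact_mod_cast this
    have h7 : s + 30 * A.C * k - (s + 30 * A.C * l) = 30 * A.C * (k - l) := by ring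
    rw [h7, abs_mul, abs_of_pos (by linarith : 0 < 30 * A.C)] at h5
    nlinarith

variable [ProperlyDiscontinuousSMul G X]

/-- A long projection gives more pairs (I, J) than there are elements moving o by at most 28C. Two
of the elements h^(-J) g h^I then coincide, so g conjugates a nontrivial power of h to a power of h.
-/
theorem exists_proj_bound {g : G} (hg : g ∉ elementaryClosure h) :
    ∃ R, ∀ i : ℤ, dist (A.proj (g • h ^ i • o)) o ≤ R := by
  have hfin := finite_setOf_dist_smul_le (G := G) o (28 * A.C)
  set F := {k : G | dist o (k • o) ≤ 28 * A.C}
  set n := F.ncard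
  refine ⟨20 * A.C + 30 * A.C * n + dist (A.proj (g • h ^ (0 : ℤ) • o)) o, fun i => ?_⟩
  by_contra hlt
  push Not at hlt
  have htri := dist_triangle (A.proj (g • h ^ i • o)) (A.proj (g • h ^ (0 : ℤ) • o)) o
  obtain ⟨I, J, hIJ, hinj⟩ := A.exists_fellow_travel hX (g := g) (i := i) (j := 0) n (by linarith)
  have hmaps : ∀ k ∈ Finset.range (n + 1), h ^ (-J k) * g * h ^ I k ∈ hfin.toFinset := by
    intro k hk
    rw [hfin.mem_toFinset]
    have := hIJ k (Nat.lt_succ_iff.1 (Finset.mem_range.1 hk))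
    rw [← dist_smul (h ^ (-J k)), zpow_neg, inv_smul_smul, dist_comm] at this
    simpa only [F, Set.mem_ofPred_eq, mul_smul, zpow_neg] using this
  obtain ⟨k, hk, l, hl, hne, he⟩ := Finset.exists_ne_map_eq_of_card_lt_of_maps_to
    (by rw [← Set.ncard_eq_toFinset_card F hfin, Finset.card_range]; exact Nat.lt_succ_self _) hmaps
  have hk' := Nat.lt_succ_iff.1 (Finset.mem_range.1 hk)
  have hl' := Nat.lt_succ_iff.1 (Finset.mem_range.1 hl)
  refine hg (A.mem_elementaryClosure (m := I k - I l) (n := J k - J l)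
    (sub_ne_zero.2 fun hI => hne (hinj k hk' l hl' hI)) ?_)
  have : g * h ^ I k = h ^ J k * (h ^ (-J l) * g * h ^ I l) := by
    rw [← he]; group
  rw [zpow_sub, ← mul_assoc, this]
  group

/-- The elementary closure is a finite union of cosets of the cyclic subgroup. -/
theorem exists_finite_coset_reps : ∃ B : Set G, B.Finite ∧
    ∀ g ∈ elementaryClosure h, ∃ j : ℤ, ∃ b ∈ B, g = h ^ j * b := by
  have hfin := finite_setOf_dist_smul_le (G := G) o (28 * A.C)
  have hch : ∀ b : G, ∃ m n : ℤ, m ≠ 0 ∧ (b ∈ elementaryClosure h → b * h ^ m * b⁻¹ = h ^ n) := by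
    intro b
    by_cases hb : b ∈ elementaryClosure h
    · obtain ⟨m, n, hm, -, e⟩ := hb
      exact ⟨m, n, hm, fun _ => e⟩
    · exact ⟨1, 1, one_ne_zero, fun h => absurd h hb⟩
  choose m n hm hmn using hch
  refine ⟨⋃ b ∈ {k : G | dist o (k • o) ≤ 28 * A.C},
    (fun r : ℤ => b * h ^ r) '' Set.Ico 0 |m b|, hfin.biUnion fun b _ =>
      (Set.finite_Ico _ _).image _, fun g hg => ?_⟩
  obtain ⟨k, l, hk, hl, e⟩ := hg
  -- A large power of h moves the projection of g o far enough for one fellow-travelling pair, which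
  -- puts h^(-J) g h^I in a finite set.
  obtain ⟨N, hN, hd⟩ := A.exists_lt_dist (22 * A.C)
  have e' : g * h ^ (k * N) = h ^ (l * N) * g := by
    have := congrArg (· ^ (N : ℤ)) e
    simp only [conj_zpow, ← zpow_mul] at this
    rw [← this]; group
  have hfar : 20 * A.C + 30 * A.C * (0 : ℕ) ≤
      dist (A.proj (g • h ^ (k * N) • o)) (A.proj (g • h ^ (0 : ℤ) • o)) := by
    rw [← mul_smul, e', mul_smul, zpow_zero, one_smul]
    have h1 := A.dist_proj_zpow_smul (l * N) (g • o)
    obtain ⟨q, hq⟩ := A.exists_proj_eq (g • o)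
    rw [hq] at h1 ⊢
    have h2 := hd (l * N + q) q (by
      rw [add_sub_cancel_right, abs_mul, Nat.abs_cast]
      have : 1 ≤ |l| := Int.one_le_abs hl
      nlinarith)
    rw [zpow_add, mul_smul] at h2
    have h3 := dist_triangle_left (h ^ (l * N) • h ^ q • o) (h ^ q • o)
      (A.proj (h ^ (l * N) • g • o))
    have := A.C_pos
    push_cast
    linarith
  obtain ⟨I, J, hIJ, -⟩ := A.exists_fellow_travel hX 0 hfar
  have h0 := hIJ 0 le_rfl
  set b := h ^ (-J 0) * g * h ^ I 0 with hb
  have hbE : b ∈ elementaryClosure h := mul_mem (mul_mem (zpow_mem_elementaryClosure h _)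
    ⟨k, l, hk, hl, e⟩) (zpow_mem_elementaryClosure h _)
  have hbF : dist o (b • o) ≤ 28 * A.C := by
    rw [← dist_smul (h ^ (-J 0)), zpow_neg, inv_smul_smul, dist_comm] at h0
    simpa only [hb, mul_smul, zpow_neg] using h0
  -- Multiples of `m b` in the exponent pass to the left of b, leaving only finitely many residues
  -- on the right.
  have hbm : b * h ^ (m b * (-I 0 / m b)) = h ^ (n b * (-I 0 / m b)) * b := by
    have := congrArg (· ^ (-I 0 / m b)) (hmn b hbE)
    simp only [conj_zpow, ← zpow_mul] at this
    rw [← this]; group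
  refine ⟨J 0 + n b * (-I 0 / m b), b * h ^ (-I 0 % m b), ?_, ?_⟩
  · exact Set.mem_biUnion hbF ⟨_, ⟨Int.emod_nonneg _ (hm b), Int.emod_lt_abs _ (hm b)⟩, rfl⟩
  · calc g = h ^ J 0 * (b * h ^ (-I 0)) := by rw [hb]; group
      _ = h ^ J 0 * (b * h ^ (m b * (-I 0 / m b) + -I 0 % m b)) := by rw [Int.mul_ediv_add_emod]
      _ = h ^ (J 0 + n b * (-I 0 / m b)) * (b * h ^ (-I 0 % m b)) := by
        rw [zpow_add, ← mul_assoc b, hbm, zpow_add]; group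

theorem exists_pow_eq_zpow {e : G} (he : e ∈ elementaryClosure h) :
    ∃ k l : ℤ, k ≠ 0 ∧ e ^ k = h ^ l := by
  obtain ⟨B, hB, hrep⟩ := A.exists_finite_coset_reps hX
  choose j b hb heq using fun k : ℕ => hrep (e ^ k) (pow_mem he k)
  have := hB.to_subtype
  obtain ⟨k, l, hne, hkl⟩ := Finite.exists_ne_map_eq_of_infinite fun k : ℕ => (⟨b k, hb k⟩ : B)
  refine ⟨(k : ℤ) - l, j k - j l, by omega, ?_⟩
  rw [zpow_sub, zpow_natCast, zpow_natCast, heq k, heq l, Subtype.mk.inj hkl]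
  group

theorem mem_of_conj_zpow_mem {g : G} {a : ℤ} (ha : a ≠ 0)
    (hg : g⁻¹ * h ^ a * g ∈ elementaryClosure h) : g ∈ elementaryClosure h := by
  obtain ⟨k, l, hk, e⟩ := A.exists_pow_eq_zpow hX hg
  rw [← inv_mem_iff]
  refine A.mem_elementaryClosure (m := a * k) (n := l) (mul_ne_zero ha hk) ?_
  rw [← e, zpow_mul]
  have := conj_zpow (i := k) (a := g⁻¹) (b := h ^ a)
  rw [inv_inv] at this ⊢
  exact this.symm

theorem finiteIndex_zpowers (htop : elementaryClosure h = ⊤) :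
    (Subgroup.zpowers h).FiniteIndex := by
  obtain ⟨B, hB, hrep⟩ := A.exists_finite_coset_reps hX
  have := hB.to_subtype
  have : Finite (G ⧸ Subgroup.zpowers h) := by
    refine Finite.of_surjective (fun b : B => QuotientGroup.mk (s := Subgroup.zpowers h) (b : G)⁻¹)
      fun x => ?_
    obtain ⟨g, rfl⟩ := QuotientGroup.mk_surjective x
    obtain ⟨j, b, hb, e⟩ := hrep g⁻¹ (htop ▸ Subgroup.mem_top _)
    refine ⟨⟨b, hb⟩, QuotientGroup.eq.2 (Subgroup.mem_zpowers_iff.2 ⟨-j, ?_⟩)⟩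
    rw [← inv_inv g, e]
    group
  exact Subgroup.finiteIndex_of_finite_quotient

/-- The normal core of E(h) is finite: two of its elements with the same coset representative differ
by a power of h, and a nontrivial power of h in the core would put g in E(h). So the core lies in
the finite radical. -/
theorem exists_conj_notMem {g p : G} (hg : g ∉ elementaryClosure h) (hp : p ∉ finiteRadical G) :
    ∃ x : G, x⁻¹ * p * x ∉ elementaryClosure h := by
  by_contra hcon
  push Not at hcon
  refine hp ((le_sSup (a := (elementaryClosure h).normalCore) ⟨inferInstance, ?_⟩ :
    (elementaryClosure h).normalCore ≤ finiteRadical G) fun x => ?_)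
  · obtain ⟨B, hB, hrep⟩ := A.exists_finite_coset_reps hX
    have := hB.to_subtype
    choose j b hb heq using fun e : (elementaryClosure h).normalCore =>
      hrep e (Subgroup.normalCore_le _ e.2)
    refine Finite.of_injective (fun e => (⟨b e, hb e⟩ : B)) fun e e' hee => ?_
    have hbb : b e = b e' := Subtype.mk.inj hee
    have h1 : (e : G) * (e' : G)⁻¹ = h ^ (j e - j e') := by
      rw [heq e, heq e', hbb]; group
    by_cases hj : j e = j e'
    · rw [hj, sub_self, zpow_zero, mul_inv_eq_one] at h1
      exact Subtype.ext h1
    · refine absurd (A.mem_of_conj_zpow_mem hX (sub_ne_zero.2 hj) ?_) hg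
      rw [← h1]
      simpa using (e * e'⁻¹).2 g⁻¹
  · simpa using hcon x⁻¹

/-- A point projects close to the base point on at least one of two transverse axes. -/
theorem exists_transverse_bound {g : G} (hg : g ∉ elementaryClosure h) :
    ∃ R, ∀ x, dist (A.proj x) o ≤ R ∨ dist (A.proj (g⁻¹ • x)) o ≤ R := by
  have hC := A.C_pos
  obtain ⟨R₁, hR₁⟩ := A.exists_proj_bound hX hg
  obtain ⟨R₂, hR₂⟩ := A.exists_proj_bound hX (g := g⁻¹) (by rwa [inv_mem_iff])
  refine ⟨max (R₁ + 8 * A.C) (R₂ + 30 * A.C), fun x => ?_⟩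
  by_contra! hcon
  obtain ⟨hx, hgx⟩ := hcon
  have hx' := (le_max_left _ _).trans_lt hx
  have hgx' := (le_max_right _ _).trans_lt hgx
  -- z is a closest point to x on the translated axis gZ, and it projects near o on Z. If x projects
  -- far from o on Z, the geodesic from x to z passes near that projection while its points keep z
  -- as a closest point on gZ. So z is close to the projection to gZ of a point of Z, which is
  -- bounded.
  set z := g • A.proj (g⁻¹ • x) with hz
  obtain ⟨i, hi⟩ := A.exists_proj_eq (g⁻¹ • x)
  have hzR : dist (A.proj z) o ≤ R₁ := by rw [hz, hi]; exact hR₁ i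
  obtain ⟨γ, h0, h1, hγ⟩ := hX x z
  obtain ⟨s, t, hs, hst, ht, hsp, -⟩ := A.exists_near dist_nonneg hγ h0 h1
    (by linarith [dist_triangle (A.proj x) (A.proj z) o])
  have hγ' : IsGeodesicOn γ (dist x z) := hγ
  have hxs := hγ'.dist_eq le_rfl hs (hst.trans ht)
  have hsz := hγ'.dist_eq hs (hst.trans ht) le_rfl
  rw [h0] at hxs
  rw [h1] at hsz
  have hxz : dist x z = dist (g⁻¹ • x) (A.proj (g⁻¹ • x)) := by
    rw [hz, ← dist_smul g⁻¹, inv_smul_smul]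
  have hclose : A.proj (g⁻¹ • x) ∈
      closestPoints (Set.range fun n : ℤ => h ^ n • o) (g⁻¹ • γ s) := by
    refine ⟨(A.proj_mem _).1, le_antisymm ?_ (Metric.infDist_le_dist_of_mem (A.proj_mem _).1)⟩
    have h2 : dist (g⁻¹ • γ s) (A.proj (g⁻¹ • x)) = dist (γ s) z := by
      rw [hz, ← dist_smul g, smul_inv_smul]
    have h3 := Metric.infDist_le_infDist_add_dist (s := Set.range fun n : ℤ => h ^ n • o)
      (x := g⁻¹ • x) (y := g⁻¹ • γ s)
    rw [dist_smul, hxs, ← (A.proj_mem _).2, ← hxz] at h3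
    linarith
  have h4 := A.contracting.dist_closest_le hX (Set.range_nonempty _) hclose
    (A.proj_mem (g⁻¹ • A.proj x))
  rw [dist_smul] at h4
  obtain ⟨k, hk⟩ := A.exists_proj_eq x
  have h5 : dist (A.proj (g⁻¹ • A.proj x)) o ≤ R₂ := by rw [hk]; exact hR₂ k
  linarith [dist_triangle (A.proj (g⁻¹ • x)) (A.proj (g⁻¹ • A.proj x)) o]

end ContractingAxis

end Axis

/-! ### Moving P into general position; crossing the axis. -/

namespace ContractingAxis

variable {G X : Type*} [Group G] [MetricSpace X] [MulAction G X] {o : X} {h : G}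
  (A : ContractingAxis o h) [IsIsometricSMul G X] [ProperSpace X]
  (hX : IsGeodesicSpace X) [ProperlyDiscontinuousSMul G X]
include A hX

/-- A group element stabilizes only finitely many axes among the translates of a transverse axis
by (powers of) a contracting element, unless it stabilizes both axes. -/
theorem finite_setOf_conj_mem {g p : G} (hg : g ∉ elementaryClosure h)
    (hp : p ∈ elementaryClosure h → g⁻¹ * p * g ∉ elementaryClosure h) :
    ∃ N : ℤ, N ≠ 0 ∧ ∀ M : ℤ, M ≠ 0 → N ∣ M →
      {n : ℤ | g⁻¹ * h ^ (-(M * n)) * p * h ^ (M * n) * g ∈ elementaryClosure h}.Finite := by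
  by_cases hpE : p ∈ elementaryClosure h
  · obtain ⟨m, k, hm, hk, e⟩ := id hpE
    refine ⟨m, hm, ?_⟩
    rintro _ hM ⟨l, rfl⟩
    have hl : l ≠ 0 := right_ne_zero_of_mul hM
    have hcomm : ∀ n, g⁻¹ * h ^ (-(m * l * n)) * p * h ^ (m * l * n) * g =
        g⁻¹ * h ^ ((k - m) * l * n) * p * g := by
      intro n
      have := congrArg (· ^ (l * n)) e
      simp only [conj_zpow, ← zpow_mul] at this
      have h2 : p * h ^ (m * l * n) = h ^ (k * l * n) * p := by
        rw [mul_assoc m, mul_assoc k, ← this]; group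
      rw [mul_assoc _ p, h2, sub_mul, sub_mul, sub_eq_neg_add, zpow_add]
      group
    simp only [hcomm]
    -- If k = m, the conjugate does not depend on n and `hp` excludes it. Otherwise two admissible n
    -- give a nontrivial power of h whose conjugate by g lies in E(h).
    by_cases hkm : k = m
    · refine Set.Finite.subset Set.finite_empty fun n hn => ?_
      have hn' : g⁻¹ * h ^ ((k - m) * l * n) * p * g ∈ elementaryClosure h := hn
      simp only [hkm, sub_self, zero_mul, zpow_zero, mul_one] at hn'
      exact hp hpE hn'
    · refine Set.Subsingleton.finite fun n₁ h₁ n₂ h₂ => ?_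
      by_contra hne
      refine hg (A.mem_of_conj_zpow_mem hX (a := (k - m) * l * (n₁ - n₂)) (mul_ne_zero
        (mul_ne_zero (sub_ne_zero.2 hkm) hl) (sub_ne_zero.2 hne)) ?_)
      have h₃ := mul_mem (show g⁻¹ * h ^ ((k - m) * l * n₁) * p * g ∈ elementaryClosure h from h₁)
        (inv_mem (show g⁻¹ * h ^ ((k - m) * l * n₂) * p * g ∈ elementaryClosure h from h₂))
      convert h₃ using 1
      rw [mul_sub, zpow_sub]
      group
  · refine ⟨1, one_ne_zero, fun M hM _ => ?_⟩
    obtain ⟨B, hB, hrep⟩ := A.exists_finite_coset_reps hX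
    obtain ⟨K, hK⟩ := (hB.image fun b => dist o (b • o)).bddAbove
    obtain ⟨R₀, hR₀⟩ := A.exists_proj_bound hX hg
    obtain ⟨R, hR⟩ := A.exists_transverse_bound hX hpE
    have hfin := finite_setOf_dist_smul_le (G := G) o (R + (A.C + (K + 20 * A.C) + R₀))
    refine (hfin.preimage (f := fun n : ℤ => h ^ (M * n)) ?_).subset fun n hn => ?_
    · intro a _ b _ hab
      exact mul_left_cancel₀ hM (A.zpow_injective hab)
    have hn' : g⁻¹ * h ^ (-(M * n)) * p * h ^ (M * n) * g ∈ elementaryClosure h := hn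
    obtain ⟨j, b, hb, e⟩ := hrep _ hn'
    have hbK : dist o (b • o) ≤ K := hK ⟨b, hb, rfl⟩
    have hmain : ∀ b : G, dist o (b • o) ≤ K → ∀ j : ℤ,
        dist (A.proj (h ^ (M * n) • g • h ^ j • b • o)) (h ^ (M * n) • o) ≤
          A.C + (K + 20 * A.C) + R₀ := by
      intro b hb j
      have h1 := A.dist_proj_zpow_smul (M * n) (g • h ^ j • b • o)
      have h2 := A.proj_lipschitz hX (g • h ^ j • b • o) (g • h ^ j • o)
      rw [dist_smul, dist_smul, dist_comm _ o] at h2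
      have h3 := dist_triangle4 (A.proj (h ^ (M * n) • g • h ^ j • b • o))
        (h ^ (M * n) • A.proj (g • h ^ j • b • o)) (h ^ (M * n) • A.proj (g • h ^ j • o))
        (h ^ (M * n) • o)
      rw [dist_smul, dist_smul] at h3
      linarith [hR₀ j]
    have hx : p • h ^ (M * n) • g • o = h ^ (M * n) • g • h ^ j • b • o := by
      have e' : p * (h ^ (M * n) * g) = h ^ (M * n) * (g * (h ^ j * b)) := by rw [← e]; group
      simp only [← mul_smul]
      rw [e']
    have hK0 : 0 ≤ K := dist_nonneg.trans hbK
    change dist o (h ^ (M * n) • o) ≤ _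
    rw [dist_comm]
    -- Membership in E(h) keeps both this point and its p⁻¹-image near the translated axis h^(Mn) g
    -- Z, which projects near h^(Mn) o. One of the two projects near o, so h^(Mn) o is near o.
    rcases hR (p • h ^ (M * n) • g • o) with h1 | h1
    · rw [hx] at h1
      linarith [hmain b hbK j, dist_triangle_left (h ^ (M * n) • o) o
        (A.proj (h ^ (M * n) • g • h ^ j • b • o))]
    · rw [inv_smul_smul] at h1
      have h2 := hmain 1 (by simpa using hK0) 0
      rw [zpow_zero, one_smul, one_smul] at h2
      linarith [dist_triangle_left (h ^ (M * n) • o) o (A.proj (h ^ (M * n) • g • o))]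

/-- Finitely many elements none of which stabilizes all axes fail to stabilize a common axis. -/
theorem exists_forall_conj_notMem {P : Set G} (hP : P.Finite)
    (hx : ∀ p ∈ P, ∃ x : G, x⁻¹ * p * x ∉ elementaryClosure h) :
    ∃ x : G, ∀ p ∈ P, x⁻¹ * p * x ∉ elementaryClosure h := by
  induction P, hP using Set.Finite.induction_on with
  | empty => exact ⟨1, fun p hp => absurd hp (Set.notMem_empty p)⟩
  | @insert q S hqS hS ih =>
    obtain ⟨g, hg⟩ := ih fun p hp => hx p (Set.mem_insert_of_mem _ hp)
    by_cases hgq : g⁻¹ * q * g ∈ elementaryClosure h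
    swap
    · refine ⟨g, fun p hp => ?_⟩
      rcases hp with rfl | hp
      exacts [hgq, hg p hp]
    obtain ⟨x, hxq⟩ := hx q (Set.mem_insert _ _)
    have hxg : x⁻¹ * g ∉ elementaryClosure h := by
      intro hmem
      apply hxq
      convert mul_mem (mul_mem hmem hgq) (inv_mem hmem) using 1
      group
    have hex : ∀ p : G, ∃ N : ℤ, N ≠ 0 ∧ (p ∈ insert q S → ∀ M : ℤ, M ≠ 0 → N ∣ M →
        {n : ℤ | (x⁻¹ * g)⁻¹ * h ^ (-(M * n)) * (x⁻¹ * p * x) * h ^ (M * n) * (x⁻¹ * g) ∈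
          elementaryClosure h}.Finite) := by
      intro p
      by_cases hp : p ∈ insert q S
      · obtain ⟨N, hN, hfin⟩ := A.finite_setOf_conj_mem hX (p := x⁻¹ * p * x) hxg (by
          intro hpE
          rcases hp with rfl | hp
          · exact absurd hpE hxq
          · convert hg p hp using 2
            group)
        exact ⟨N, hN, fun _ => hfin⟩
      · exact ⟨1, one_ne_zero, fun h => absurd h hp⟩
    choose N hN hfin using hex
    have hI : (insert q S).Finite := hS.insert q
    -- A common multiple of all `N p` serves every p at once; each p then excludes only finitely
    -- many n.
    set M := ∏ p ∈ hI.toFinset, N p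
    have hM : M ≠ 0 := Finset.prod_ne_zero_iff.2 fun p _ => hN p
    obtain ⟨n, hn⟩ := (hI.biUnion fun p hp => hfin p hp M hM
      (Finset.dvd_prod_of_mem N (hI.mem_toFinset.2 hp))).exists_notMem
    refine ⟨x * h ^ (M * n) * (x⁻¹ * g), fun p hp hmem => hn (Set.mem_biUnion hp ?_)⟩
    change _ ∈ elementaryClosure h
    convert hmem using 1
    group

/-- The concatenation estimate: a geodesic from `x` to `h ^ N p h ^ (-N) y` passes near `o` and
then near `h ^ N p h ^ (-N) o`, if `x` and `y` project near `o`. -/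
theorem exists_concatenation_bound {p : G} (hp : p ∉ elementaryClosure h) (R₁ : ℝ) (hR₁ : 0 ≤ R₁) :
    ∃ R, ∀ N : ℤ, R < dist o (h ^ N • o) → ∀ x y : X, dist (A.proj x) o ≤ R₁ →
      dist (A.proj y) o ≤ R₁ →
      (∀ γ L, 0 ≤ L → IsGeodesicOn γ L → γ 0 = x → γ L = (h ^ N * p * h ^ (-N)) • y →
        (∃ r ∈ Set.Icc 0 L, dist (γ r) o ≤ R) ∧
        ∃ r ∈ Set.Icc 0 L, dist (γ r) ((h ^ N * p * h ^ (-N)) • o) ≤ R) ∧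
      dist x o + dist o (h ^ N • o) ≤ dist x ((h ^ N * p * h ^ (-N)) • o) + R := by
  have hC := A.C_pos
  obtain ⟨Rp, hRp⟩ := A.exists_transverse_bound hX hp
  have hRp0 : 0 ≤ Rp := by rcases hRp o with h1 | h1 <;> exact dist_nonneg.trans h1
  refine ⟨50 * A.C + 3 * R₁ + 2 * Rp, fun N hN x y hx hy => ?_⟩
  set T := dist o (h ^ N • o) with hT
  have hT' : dist o (h ^ (-N) • o) = T := by
    rw [← dist_smul (h ^ N), zpow_neg, smul_inv_smul, dist_comm]
  have hshift : ∀ z : X, dist (A.proj z) o ≤ R₁ →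
      dist (A.proj (h ^ (-N) • z)) (h ^ (-N) • o) ≤ A.C + R₁ := by
    intro z hz
    have h1 := A.dist_proj_zpow_smul (-N) z
    rw [← dist_smul (h ^ (-N))] at hz
    linarith [dist_triangle (A.proj (h ^ (-N) • z)) (h ^ (-N) • A.proj z) (h ^ (-N) • o)]
  have hfar : ∀ z : X, dist (A.proj z) o ≤ R₁ →
      T - A.C - R₁ ≤ dist (A.proj (h ^ (-N) • z)) o := by
    intro z hz
    have := dist_triangle_left o (h ^ (-N) • o) (A.proj (h ^ (-N) • z))
    rw [hT'] at this
    linarith [hshift z hz]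
  -- Since h^(-N) z projects far from o, transversality of p forces p h^(-N) z to project near o;
  -- h^N then carries this to h^N o.
  have htarget : ∀ z : X, dist (A.proj z) o ≤ R₁ →
      dist (A.proj ((h ^ N * p * h ^ (-N)) • z)) (h ^ N • o) ≤ A.C + Rp := by
    intro z hz
    have h1 : dist (A.proj (p • h ^ (-N) • z)) o ≤ Rp := by
      rcases hRp (p • h ^ (-N) • z) with h1 | h1
      · exact h1
      · rw [inv_smul_smul] at h1
        linarith [hfar z hz]
    have h2 := A.dist_proj_zpow_smul N (p • h ^ (-N) • z)
    rw [← dist_smul (h ^ N)] at h1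
    rw [mul_smul, mul_smul]
    linarith [dist_triangle (A.proj (h ^ N • p • h ^ (-N) • z))
      (h ^ N • A.proj (p • h ^ (-N) • z)) (h ^ N • o)]
  have hsep : ∀ z : X, dist (A.proj z) o ≤ R₁ →
      T - R₁ - A.C - Rp ≤ dist (A.proj x) (A.proj ((h ^ N * p * h ^ (-N)) • z)) := by
    intro z hz
    have := dist_triangle4 o (A.proj x) (A.proj ((h ^ N * p * h ^ (-N)) • z)) (h ^ N • o)
    rw [dist_comm o (A.proj x)] at this
    linarith [htarget z hz]
  refine ⟨fun γ L hL hγ h0 h1 => ⟨?_, ?_⟩, ?_⟩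
  · obtain ⟨s, t, hs, hst, ht, hsp, -⟩ := A.exists_near hL hγ h0 h1 (by linarith [hsep y hy])
    exact ⟨s, ⟨hs, hst.trans ht⟩, by linarith [dist_triangle (γ s) (A.proj x) o]⟩
  -- The second near point is found on the axis translated by h^N p, with the roles of x and y
  -- exchanged.
  · have hx2 : dist (A.proj (p⁻¹ • h ^ (-N) • x)) o ≤ Rp := by
      rcases hRp (h ^ (-N) • x) with h2 | h2
      · linarith [hfar x hx]
      · exact h2
    obtain ⟨s, t, hs, hst, ht, -, htq, -⟩ := A.exists_near (γ := fun r => (h ^ N * p)⁻¹ • γ r)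
      (x := p⁻¹ • h ^ (-N) • x) (y := h ^ (-N) • y) hL
      (fun a ha b hb => by simp only [dist_smul]; exact hγ a ha b hb)
      (by simp only [h0, mul_inv_rev, mul_smul, zpow_neg])
      (by simp only [h1, mul_smul, mul_inv_rev, inv_smul_smul])
      (by linarith [hfar y hy, dist_triangle_left (A.proj (h ^ (-N) • y)) o
            (A.proj (p⁻¹ • h ^ (-N) • x)), dist_comm o (A.proj (h ^ (-N) • y)),
            dist_triangle_left o (A.proj (h ^ (-N) • y)) (A.proj (p⁻¹ • h ^ (-N) • x)),
            dist_triangle (A.proj (h ^ (-N) • y)) (A.proj (p⁻¹ • h ^ (-N) • x)) o,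
            dist_comm (A.proj (h ^ (-N) • y)) (A.proj (p⁻¹ • h ^ (-N) • x))])
    refine ⟨t, ⟨hs.trans hst, ht⟩, ?_⟩
    have h3 := dist_triangle ((h ^ N * p)⁻¹ • γ t) (A.proj (h ^ (-N) • y)) (h ^ (-N) • o)
    rw [← dist_smul (h ^ N * p) ((h ^ N * p)⁻¹ • γ t) (h ^ (-N) • o), smul_inv_smul, ← mul_smul]
      at h3
    linarith [hshift y hy]
  · have ho : dist (A.proj o) o ≤ R₁ := by rw [A.proj_base, dist_self]; exact hR₁
    have h1 := A.contracting.dist_add_dist_le hX (Set.range_nonempty _) (A.proj_mem x)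
      (A.proj_mem ((h ^ N * p * h ^ (-N)) • o)) (by linarith [hsep o ho])
    have h2 := A.proj_lipschitz hX (A.proj x) ((h ^ N * p * h ^ (-N)) • o)
    obtain ⟨k, hk⟩ := A.exists_proj_eq x
    have h3 : A.proj (A.proj x) = A.proj x := by rw [hk, A.proj_zpow_smul]
    rw [h3] at h2
    linarith [hsep o ho, dist_triangle x (A.proj x) o]

end ContractingAxis

section OrbitLength

variable {G X : Type*} [Group G] [MetricSpace X] [MulAction G X] [IsIsometricSMul G X]

theorem dist_smul_mul_le (o : X) (a b : G) :
    dist o ((a * b) • o) ≤ dist o (a • o) + dist o (b • o) := by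
  have := dist_triangle o (a • o) (a • b • o)
  rwa [dist_smul, ← mul_smul] at this

theorem dist_smul_inv (o : X) (a : G) : dist o (a⁻¹ • o) = dist o (a • o) := by
  rw [← dist_smul a, smul_inv_smul, dist_comm]

theorem dist_smul_smul (o : X) (a b : G) : dist (a • o) (b • o) = dist o ((a⁻¹ * b) • o) := by
  rw [← dist_smul a⁻¹, inv_smul_smul, mul_smul]

end OrbitLength

/-! ### Concatenating group elements. -/

section Concatenation

variable {G X : Type*} [Group G] [MetricSpace X] [MulAction G X] {o : X} {h : G}

/-- The first part of a concatenation, ending after the inserted conjugate of `p w`. -/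
def concatPrefix (k : G) (ε p : G → G) (w : G) : G := w * ε w⁻¹ * (k * p w * k⁻¹)

/-- The concatenation of `w` and `v` with a conjugate of `p w` inserted between them. -/
def concatenation (k : G) (ε p : G → G) (w v : G) : G := concatPrefix k ε p w * (ε v)⁻¹ * v

/-- Transversality of g ensures that v o or g⁻¹v o projects near o, and ε v records which. R depends
neither on N nor on the choice of p, so N may be chosen after R. -/
theorem ContractingAxis.exists_concatenation (A : ContractingAxis o h) [IsIsometricSMul G X]
    [ProperSpace X] (hX : IsGeodesicSpace X) [ProperlyDiscontinuousSMul G X] {g : G}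
    (hg : g ∉ elementaryClosure h) {P : Set G} (hPfin : P.Finite)
    (hP : ∀ p ∈ P, p ∉ elementaryClosure h) :
    ∃ (ε : G → G) (R : ℝ), (∀ v, ε v = 1 ∨ ε v = g) ∧ (∀ v, dist o (ε v • o) ≤ R) ∧
      ∀ N : ℤ, R < dist o (h ^ N • o) → ∀ p : G → G, (∀ w, p w ∈ P) → ∀ w : G,
        (∀ v γ L, 0 ≤ L → IsGeodesicOn γ L → γ 0 = o →
          γ L = concatenation (h ^ N) ε p w v • o →
          (∃ r ∈ Set.Icc 0 L, dist (γ r) (w • o) ≤ R) ∧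
          ∃ r ∈ Set.Icc 0 L, dist (γ r) (concatPrefix (h ^ N) ε p w • o) ≤ R) ∧
        dist o (w • o) + dist o (h ^ N • o) ≤ dist o (concatPrefix (h ^ N) ε p w • o) + R := by
  classical
  obtain ⟨R₁, hR₁⟩ := A.exists_transverse_bound hX hg
  have hR₁0 : 0 ≤ R₁ := by rcases hR₁ o with h1 | h1 <;> exact dist_nonneg.trans h1
  have hex : ∀ p : G, ∃ R, p ∈ P → _ := fun p => by
    by_cases hp : p ∈ P
    · obtain ⟨R, hR⟩ := A.exists_concatenation_bound hX (hP p hp) R₁ hR₁0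
      exact ⟨R, fun _ => hR⟩
    · exact ⟨0, fun h => absurd h hp⟩
  choose S hS using hex
  obtain ⟨K, hK⟩ := (hPfin.image S).bddAbove
  refine ⟨fun v => if dist (A.proj (v • o)) o ≤ R₁ then 1 else g, max K 0 + dist o (g • o),
    fun v => by dsimp only; split_ifs <;> simp, fun v => ?_, fun N hN p hp w => ?_⟩
  · dsimp only
    split_ifs
    · rw [one_smul, dist_self]
      exact add_nonneg (le_max_right _ _) dist_nonneg
    · linarith [le_max_right K 0]
  · set ε : G → G := fun v => if dist (A.proj (v • o)) o ≤ R₁ then 1 else g with hε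
    have hεR : ∀ v, dist (A.proj ((ε v)⁻¹ • v • o)) o ≤ R₁ := by
      intro v
      simp only [hε]
      split_ifs with hv
      · simpa using hv
      · exact (hR₁ (v • o)).resolve_left hv
    have hεg : ∀ v, dist o (ε v • o) ≤ dist o (g • o) := by
      intro v
      simp only [hε]
      split_ifs
      · rw [one_smul, dist_self]; exact dist_nonneg
      · exact le_rfl
    have hSK : S (p w) ≤ max K 0 := (hK ⟨p w, hp w, rfl⟩).trans (le_max_left _ _)
    have hg0 : 0 ≤ dist o (g • o) := dist_nonneg
    set u := w * ε w⁻¹ with hu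
    have hux : u⁻¹ • o = (ε w⁻¹)⁻¹ • w⁻¹ • o := by rw [hu, mul_inv_rev, mul_smul]
    have hmain := fun v => hS (p w) (hp w) N (by linarith) (u⁻¹ • o) ((ε v)⁻¹ • v • o)
      (by rw [hux]; exact hεR _) (hεR v)
    have hpre : concatPrefix (h ^ N) ε p w • o = u • (h ^ N * p w * h ^ (-N)) • o := by
      rw [concatPrefix, ← mul_smul, zpow_neg]
    constructor
    · intro v γ L hL hγ h0 h1
      obtain ⟨⟨r, hr, h2⟩, r', hr', h3⟩ := (hmain v).1 (fun r => u⁻¹ • γ r) L hL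
        (fun a ha b hb => by simp only [dist_smul]; exact hγ a ha b hb) (by rw [h0]) (by
          rw [h1, concatenation, concatPrefix]
          simp only [← mul_smul, zpow_neg]
          congr 1
          rw [hu]
          group)
      refine ⟨⟨r, hr, ?_⟩, r', hr', ?_⟩
      · rw [← dist_smul u, smul_inv_smul] at h2
        have h4 : dist (u • o) (w • o) = dist o (ε w⁻¹ • o) := by
          rw [hu, mul_smul, dist_smul, dist_comm]
        linarith [dist_triangle (γ r) (u • o) (w • o), hεg w⁻¹]
      · rw [← dist_smul u, smul_inv_smul, ← hpre] at h3
        linarith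
    · have h2 := (hmain 1).2
      rw [← dist_smul u (u⁻¹ • o) o, smul_inv_smul,
        ← dist_smul u (u⁻¹ • o) ((h ^ N * p w * h ^ (-N)) • o), smul_inv_smul, ← hpre] at h2
      have h3 := dist_smul_mul_le o u (ε w⁻¹)⁻¹
      rw [dist_smul_inv, hu, mul_inv_cancel_right] at h3
      linarith [hεg w⁻¹]

end Concatenation

/-! ### Multiplicity of concatenation and Poincaré series. -/

section Counting

variable {G X : Type*} [Group G] [MetricSpace X] [MulAction G X] [IsIsometricSMul G X]

theorem dist_concatenation_le {o : X} {k : G} {ε p : G → G} {R Q : ℝ}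
    (hε : ∀ v, dist o (ε v • o) ≤ R) (hp : ∀ w, dist o (p w • o) ≤ Q) (w v : G) :
    dist o (concatPrefix k ε p w • o) ≤ dist o (w • o) + (R + 2 * dist o (k • o) + Q) ∧
    dist o (concatenation k ε p w v • o) ≤
      dist o (w • o) + dist o (v • o) + (2 * R + 2 * dist o (k • o) + Q) := by
  have h1 := dist_smul_mul_le o w (ε w⁻¹)
  have h2 := dist_smul_mul_le o k (p w)
  have h3 := dist_smul_mul_le o (k * p w) k⁻¹
  have h4 := dist_smul_mul_le o (w * ε w⁻¹) (k * p w * k⁻¹)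
  have h5 := dist_smul_mul_le o (concatPrefix k ε p w) (ε v)⁻¹
  have h6 := dist_smul_mul_le o (concatPrefix k ε p w * (ε v)⁻¹) v
  rw [dist_smul_inv] at h3 h5
  have := hε w⁻¹
  have := hε v
  have := hp w
  simp only [concatenation, concatPrefix] at *
  constructor <;> linarith

/-- The term of the Poincaré series of the action at the group element `g`. -/
noncomputable def poincareTerm (o : X) (s : ℝ) (g : G) : ℝ≥0∞ :=
  ENNReal.ofReal (Real.exp (-s * dist o (g • o)))

/-- If concatenation with elements of `W` has bounded ambiguity, then the Poincaré series over `W`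
times the full Poincaré series is bounded by a multiple of the full Poincaré series. -/
theorem tsum_poincareTerm_mul_le (hX : IsGeodesicSpace X) {o : X} {k g : G} {ε p : G → G}
    {R c L : ℝ} (hε : ∀ v, ε v = 1 ∨ ε v = g)
    (hc : ∀ w v, dist o (concatenation k ε p w v • o) ≤ dist o (w • o) + dist o (v • o) + c)
    (hnear : ∀ w v γ L, 0 ≤ L → IsGeodesicOn γ L → γ 0 = o → γ L = concatenation k ε p w v • o →
      ∃ r ∈ Set.Icc 0 L, dist (γ r) (w • o) ≤ R)
    (hfin : {b : G | dist o (b • o) ≤ L + 4 * R}.Finite)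
    {W : Set G} (hW : ∀ w₁ ∈ W, ∀ w₂ ∈ W, ∀ v₁ v₂,
      concatenation k ε p w₁ v₁ = concatenation k ε p w₂ v₂ →
      dist o (w₂ • o) ≤ dist o (w₁ • o) + L) {s : ℝ} (hs : 0 ≤ s) :
    (∑' w : W, poincareTerm o s (w : G)) * ∑' v : G, poincareTerm o s v ≤
      ENNReal.ofReal (Real.exp (s * c)) *
        (2 * ({b : G | dist o (b • o) ≤ L + 4 * R}.ncard : ℝ≥0∞)) *
        ∑' x : G, poincareTerm o s x := by
  classical
  set F := {b : G | dist o (b • o) ≤ L + 4 * R} with hF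
  -- All possible w for a given product lie R-close to one geodesic and have lengths within L, hence
  -- are (L + 4R)-close to each other.
  have hdec : ∀ x : G, ∃ w₀ : G, ∀ w ∈ W, ∀ v, concatenation k ε p w v = x → w₀⁻¹ * w ∈ F := by
    intro x
    by_cases hx : ∃ w₀ ∈ W, ∃ v₀, concatenation k ε p w₀ v₀ = x
    · obtain ⟨w₀, hw₀, v₀, e₀⟩ := hx
      refine ⟨w₀, fun w hw v e => ?_⟩
      obtain ⟨γ, h0, h1, hγ⟩ := hX o (x • o)
      have hγ' : IsGeodesicOn γ (dist o (x • o)) := hγ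
      obtain ⟨a₀, ha₀, hd₀⟩ := hnear w₀ v₀ γ _ dist_nonneg hγ h0 (by rw [h1, e₀])
      obtain ⟨a, ha, hd⟩ := hnear w v γ _ dist_nonneg hγ h0 (by rw [h1, e])
      have l₀ := hγ'.dist_eq le_rfl ha₀.1 ha₀.2
      have l₁ := hγ'.dist_eq le_rfl ha.1 ha.2
      have l₂ := hγ a₀ ha₀ a ha
      rw [h0, sub_zero] at l₀ l₁
      have h2 := hW w₀ hw₀ w hw v₀ v (e₀.trans e.symm)
      have h3 := hW w hw w₀ hw₀ v v₀ (e.trans e₀.symm)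
      change dist o ((w₀⁻¹ * w) • o) ≤ L + 4 * R
      rw [← dist_smul_smul]
      have h4 := dist_triangle4 (w₀ • o) (γ a₀) (γ a) (w • o)
      rw [dist_comm (w₀ • o) (γ a₀), l₂] at h4
      have h5 := dist_triangle o (γ a) (w • o)
      have h6 := dist_triangle_right o (γ a) (w • o)
      have h7 := dist_triangle o (γ a₀) (w₀ • o)
      have h8 := dist_triangle_right o (γ a₀) (w₀ • o)
      have h9 : |a₀ - a| ≤ L + 2 * R := abs_le.2 ⟨by linarith, by linarith⟩
      linarith
    · push Not at hx
      exact ⟨1, fun w hw v e => absurd e (hx w hw v)⟩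
  choose w₀ hw₀ using hdec
  -- The product and w₀⁻¹w determine w; the bit determines ε v, after which v is found by
  -- cancellation.
  let Ψ : W × G → G × F × Bool := fun q =>
    (concatenation k ε p q.1 q.2, ⟨_, hw₀ _ q.1 q.1.2 q.2 rfl⟩, decide (ε q.2 = 1))
  have hΨ : Function.Injective Ψ := by
    rintro ⟨⟨w, hw⟩, v⟩ ⟨⟨w', hw'⟩, v'⟩ hq
    simp only [Ψ, Prod.mk.injEq, Subtype.mk.injEq, decide_eq_decide] at hq
    obtain ⟨h1, h2, h3⟩ := hq
    rw [h1] at h2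
    have hww : w = w' := mul_left_cancel h2
    subst hww
    have hεv : ε v = ε v' := by
      by_cases h4 : ε v = 1
      · rw [h4, h3.1 h4]
      · rw [(hε v).resolve_left h4, (hε v').resolve_left fun h5 => h4 (h3.2 h5)]
    rw [concatenation, concatenation, hεv] at h1
    rw [mul_left_cancel h1]
  have := hfin.fintype
  calc (∑' w : W, poincareTerm o s (w : G)) * ∑' v : G, poincareTerm o s v
      = ∑' q : W × G, poincareTerm o s (q.1 : G) * poincareTerm o s q.2 := by
        rw [ENNReal.tsum_prod', ← ENNReal.tsum_mul_right]
        simp_rw [ENNReal.tsum_mul_left]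
    _ ≤ ∑' q : W × G, (fun y : G × F × Bool =>
          ENNReal.ofReal (Real.exp (s * c)) * poincareTerm o s y.1) (Ψ q) := by
        refine ENNReal.tsum_le_tsum fun q => ?_
        simp only [poincareTerm, Ψ]
        rw [← ENNReal.ofReal_mul (Real.exp_nonneg _), ← ENNReal.ofReal_mul (Real.exp_nonneg _),
          ← Real.exp_add, ← Real.exp_add]
        refine ENNReal.ofReal_le_ofReal (Real.exp_le_exp.2 ?_)
        nlinarith [hc q.1 q.2]
    _ ≤ ∑' y : G × F × Bool, ENNReal.ofReal (Real.exp (s * c)) * poincareTerm o s y.1 :=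
        ENNReal.tsum_comp_le_tsum_of_injective hΨ _
    _ = _ := by
        rw [ENNReal.tsum_prod']
        simp only [ENNReal.tsum_const, ENat.card_eq_coe_fintype_card, Fintype.card_prod,
          Fintype.card_bool]
        rw [ENNReal.tsum_mul_left, ENNReal.tsum_mul_left, Set.ncard_eq_toFinset_card',
          Set.toFinset_card]
        push_cast
        ring

end Counting

/-! ### Growth estimates from Poincaré series. -/

section Growth

variable {G X : Type*} [Group G] [MetricSpace X] [MulAction G X]

theorem finite_orbitBall [ProperSpace X] [ProperlyDiscontinuousSMul G X] (o : X) (n : ℕ) :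
    (orbitBall G o n).Finite := finite_setOf_dist_smul_le o n

theorem one_le_ncard_orbitBall [ProperSpace X] [ProperlyDiscontinuousSMul G X] (o : X) (n : ℕ) :
    1 ≤ (orbitBall G o n).ncard := by
  refine (Set.ncard_pos (finite_orbitBall o n)).2 ⟨1, ?_⟩
  change dist o ((1 : G) • o) ≤ n
  simp

theorem tsum_poincareTerm_ne_top [ProperSpace X] [ProperlyDiscontinuousSMul G X] {o : X} {s : ℝ}
    (hs : 0 < s) (hlt : growthRate G o < s) : ∑' g : G, poincareTerm o s g ≠ ⊤ := by
  obtain ⟨s', hs', hs's⟩ := EReal.lt_iff_exists_real_btwn.1 hlt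
  rw [EReal.coe_lt_coe_iff] at hs's
  have hsum : Summable fun n : ℕ => ((orbitBall G o n).ncard : ℝ) * Real.exp (-s * (n - 1)) := by
    refine Summable.of_norm_bounded_eventually_nat (g := fun n : ℕ =>
      Real.exp s * Real.exp (s' - s) ^ n) ((summable_geometric_of_lt_one (Real.exp_nonneg _)
        (Real.exp_lt_one_iff.2 (by linarith))).mul_left _) ?_
    filter_upwards [eventually_lt_of_limsup_lt hs', eventually_gt_atTop 0] with n hn hn0
    rw [EReal.coe_lt_coe_iff, div_lt_iff₀ (by exact_mod_cast hn0), Real.log_lt_iff_lt_exp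
      (by exact_mod_cast one_le_ncard_orbitBall o n)] at hn
    rw [Real.norm_of_nonneg (by positivity)]
    calc ((orbitBall G o n).ncard : ℝ) * Real.exp (-s * (n - 1))
        ≤ Real.exp (s' * n) * Real.exp (-s * (n - 1)) := by gcongr
      _ = Real.exp s * Real.exp (s' - s) ^ n := by
        rw [← Real.exp_nat_mul, ← Real.exp_add, ← Real.exp_add]
        congr 1
        ring
  refine ne_top_of_le_ne_top hsum.tsum_ofReal_ne_top ?_
  calc ∑' g : G, poincareTerm o s g
      ≤ ∑' g : G, ∑' n : ℕ, (orbitBall G o n).indicator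
          (fun _ => ENNReal.ofReal (Real.exp (-s * (n - 1)))) g := by
        refine ENNReal.tsum_le_tsum fun g => ?_
        refine le_trans ?_ (ENNReal.le_tsum ⌈dist o (g • o)⌉₊)
        have hmem : g ∈ orbitBall G o ⌈dist o (g • o)⌉₊ := Nat.le_ceil (dist o (g • o))
        rw [Set.indicator_of_mem hmem]
        refine ENNReal.ofReal_le_ofReal (Real.exp_le_exp.2 ?_)
        nlinarith [Nat.ceil_lt_add_one (dist_nonneg (x := o) (y := g • o))]
    _ = ∑' n : ℕ, ∑' g : G, (orbitBall G o n).indicator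
          (fun _ => ENNReal.ofReal (Real.exp (-s * (n - 1)))) g := ENNReal.tsum_comm
    _ = ∑' n : ℕ, ENNReal.ofReal (((orbitBall G o n).ncard : ℝ) * Real.exp (-s * (n - 1))) := by
        refine tsum_congr fun n => ?_
        rw [← tsum_subtype, ENNReal.tsum_const, ENNReal.ofReal_mul (Nat.cast_nonneg _),
          ENNReal.ofReal_natCast, ENat.card_coe_set_eq, ← (finite_orbitBall o n).cast_ncard_eq]
        rfl

/-- Each w contributes e^{-nω} once n ≥ |w|. This tends to 0 and is dominated by the summable
e^{-ω|w|}. -/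
theorem tendsto_ncard_inter_orbitBall_mul_exp [ProperSpace X] [ProperlyDiscontinuousSMul G X]
    {o : X} {W : Set G} {ω : ℝ} (hω : 0 < ω) {K : ℝ}
    (hK : ∀ F : Finset W, ∑ w ∈ F, Real.exp (-ω * dist o ((w : G) • o)) ≤ K) :
    Tendsto (fun n : ℕ => ((W ∩ orbitBall G o n).ncard : ℝ) * Real.exp (-(n * ω))) atTop
      (𝓝 0) := by
  classical
  have hsum : Summable fun w : W => Real.exp (-ω * dist o ((w : G) • o)) :=
    summable_of_sum_le (fun _ => Real.exp_nonneg _) hK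
  have hdom := tendsto_tsum_of_dominated_convergence (𝓕 := atTop) (f := fun (n : ℕ) (w : W) =>
    if dist o ((w : G) • o) ≤ n then Real.exp (-(n * ω)) else 0) (g := fun _ => 0) hsum (by
      intro w
      have hexp : Tendsto (fun n : ℕ => Real.exp (-(n * ω))) atTop (𝓝 0) :=
        Real.tendsto_exp_neg_atTop_nhds_zero.comp
          (tendsto_natCast_atTop_atTop.atTop_mul_const hω)
      refine squeeze_zero (fun n => ?_) (fun n => ?_) hexp
      · split_ifs
        exacts [Real.exp_nonneg _, le_rfl]
      · split_ifs
        exacts [le_rfl, Real.exp_nonneg _]) (Eventually.of_forall fun n w => by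
      split_ifs with h
      · rw [Real.norm_of_nonneg (Real.exp_nonneg _)]
        refine Real.exp_le_exp.2 ?_
        nlinarith
      · rw [norm_zero]; exact Real.exp_nonneg _)
  rw [tsum_zero] at hdom
  refine hdom.congr fun n => ?_
  have hfin' : {w : W | dist o ((w : G) • o) ≤ n}.Finite :=
    (finite_orbitBall (G := G) o n).preimage Subtype.val_injective.injOn
  have hsum' : ∑ w ∈ hfin'.toFinset, (if dist o ((w : G) • o) ≤ n then Real.exp (-(n * ω)) else 0) =
      ∑ w ∈ hfin'.toFinset, Real.exp (-(n * ω)) :=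
    Finset.sum_congr rfl fun w hw => if_pos (hfin'.mem_toFinset.1 hw)
  have htsum : ∑' w : W, (if dist o ((w : G) • o) ≤ n then Real.exp (-(n * ω)) else 0) =
      ∑ w ∈ hfin'.toFinset, (if dist o ((w : G) • o) ≤ n then Real.exp (-(n * ω)) else 0) :=
    tsum_eq_sum fun w hw => if_neg fun h => hw (hfin'.mem_toFinset.2 h)
  rw [htsum, hsum', Finset.sum_const, nsmul_eq_mul, ← Set.ncard_eq_toFinset_card _ hfin']
  congr 2
  rw [← Set.ncard_image_of_injective _ Subtype.val_injective]
  congr 1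
  ext w
  constructor
  · rintro ⟨w, hw, rfl⟩
    exact ⟨w.2, hw⟩
  · rintro ⟨hw, hw'⟩
    exact ⟨⟨w, hw⟩, hw', rfl⟩

variable [IsIsometricSMul G X]

/-- Above the growth rate the full Poincaré series is finite and nonzero, so it cancels. The
remaining bound does not blow up as s decreases to the growth rate. -/
theorem sum_exp_le_of_concatenation [ProperSpace X] [ProperlyDiscontinuousSMul G X]
    (hX : IsGeodesicSpace X) {o : X} {k g : G} {ε p : G → G}
    {R c L : ℝ} (hε : ∀ v, ε v = 1 ∨ ε v = g)
    (hc : ∀ w v, dist o (concatenation k ε p w v • o) ≤ dist o (w • o) + dist o (v • o) + c)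
    (hnear : ∀ w v γ L, 0 ≤ L → IsGeodesicOn γ L → γ 0 = o → γ L = concatenation k ε p w v • o →
      ∃ r ∈ Set.Icc 0 L, dist (γ r) (w • o) ≤ R)
    {W : Set G} (hW : ∀ w₁ ∈ W, ∀ w₂ ∈ W, ∀ v₁ v₂,
      concatenation k ε p w₁ v₁ = concatenation k ε p w₂ v₂ →
      dist o (w₂ • o) ≤ dist o (w₁ • o) + L) {s : ℝ} (hs : 0 < s) (hlt : growthRate G o < s)
    (F : Finset W) :
    ∑ w ∈ F, Real.exp (-s * dist o ((w : G) • o)) ≤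
      Real.exp (s * c) * (2 * ({b : G | dist o (b • o) ≤ L + 4 * R}.ncard : ℝ)) := by
  have h1 := tsum_poincareTerm_mul_le hX hε hc hnear (finite_setOf_dist_smul_le o _) hW hs.le
  have h0 : ∑' g : G, poincareTerm o s g ≠ 0 := by
    refine ne_of_gt (lt_of_lt_of_le ?_ (ENNReal.le_tsum (1 : G)))
    exact ENNReal.ofReal_pos.2 (Real.exp_pos _)
  rw [ENNReal.mul_le_mul_iff_left h0 (tsum_poincareTerm_ne_top hs hlt)] at h1
  have h2 := (ENNReal.sum_le_tsum F).trans h1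
  simp only [poincareTerm] at h2
  rw [← ENNReal.ofReal_sum_of_nonneg fun _ _ => Real.exp_nonneg _, ← ENNReal.ofReal_natCast,
    ← ENNReal.ofReal_ofNat, ← ENNReal.ofReal_mul (by norm_num),
    ← ENNReal.ofReal_mul (Real.exp_nonneg _), ENNReal.ofReal_le_ofReal_iff (by positivity)] at h2
  exact h2

/-- If the growth rate is not positive, then balls grow at most linearly. -/
theorem exists_ncard_orbitBall_le_of_growthRate_nonpos [ProperSpace X]
    [ProperlyDiscontinuousSMul G X]
    (hX : IsGeodesicSpace X) {o : X} {k g : G} {ε p : G → G} {R c : ℝ}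
    (hε : ∀ v, ε v = 1 ∨ ε v = g)
    (hc : ∀ w v, dist o (concatenation k ε p w v • o) ≤ dist o (w • o) + dist o (v • o) + c)
    (hnear : ∀ w v γ L, 0 ≤ L → IsGeodesicOn γ L → γ 0 = o → γ L = concatenation k ε p w v • o →
      ∃ r ∈ Set.Icc 0 L, dist (γ r) (w • o) ≤ R) (hω : growthRate G o ≤ 0) :
    ∃ K : ℕ, ∀ n : ℕ, (orbitBall G o n).ncard ≤ K * (n + 1) := by
  classical
  set M : ℝ := 2 * ({b : G | dist o (b • o) ≤ 1 + 4 * R}.ncard : ℝ) with hM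
  have hM0 : 0 ≤ M := by positivity
  refine ⟨⌊Real.exp (1 + |c|) * M⌋₊, fun n => ?_⟩
  have hfin := finite_orbitBall (G := G) o n
  rw [Set.ncard_eq_toFinset_card _ hfin]
  have := Finset.card_le_mul_card_image_of_maps_to (s := hfin.toFinset)
    (t := Finset.range (n + 1)) (f := fun w => ⌊dist o (w • o)⌋₊) (fun w hw => by
      rw [Finset.mem_range, Nat.lt_succ_iff]
      exact Nat.floor_le_of_le (hfin.mem_toFinset.1 hw)) ⌊Real.exp (1 + |c|) * M⌋₊ (fun t _ => by
      -- On a shell of width 1 the lengths are comparable with L = 1, and s = 1/(t + 1) makes every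
      -- term at least e^{-1}; so shells have bounded size.
      set S := hfin.toFinset.filter fun w => ⌊dist o (w • o)⌋₊ = t with hS
      have hlen : ∀ w ∈ S, (t : ℝ) ≤ dist o (w • o) ∧ dist o (w • o) ≤ t + 1 := by
        intro w hw
        have := (Finset.mem_filter.1 hw).2
        rw [Nat.floor_eq_iff dist_nonneg] at this
        exact ⟨this.1, this.2.le⟩
      have ht : (0 : ℝ) < t + 1 := by positivity
      have hmain := sum_exp_le_of_concatenation hX (W := (S : Set G)) (L := 1)
        (s := 1 / ((t : ℝ) + 1)) hε hc hnear
        (fun w₁ h₁ w₂ h₂ _ _ _ => by linarith [(hlen w₁ h₁).1, (hlen w₂ h₂).2])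
        (by positivity) (hω.trans_lt (by exact_mod_cast (by positivity : 0 < 1 / ((t : ℝ) + 1))))
        Finset.univ
      have hlow : (S.card : ℝ) * Real.exp (-1) ≤
          ∑ w : (S : Set G), Real.exp (-(1 / ((t : ℝ) + 1)) * dist o ((w : G) • o)) := by
        have hcard : (Finset.univ : Finset (S : Set G)).card = S.card := by simp
        rw [← hcard, ← nsmul_eq_mul]
        refine Finset.card_nsmul_le_sum _ _ _ fun w _ => Real.exp_le_exp.2 ?_
        rw [neg_mul, neg_le_neg_iff, one_div, inv_mul_le_iff₀ ht, mul_one]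
        exact (hlen w w.2).2
      refine Nat.le_floor ?_
      have hexp : Real.exp (1 / ((t : ℝ) + 1) * c) ≤ Real.exp |c| := by
        refine Real.exp_le_exp.2 ?_
        rw [one_div, inv_mul_le_iff₀ ht]
        nlinarith [le_abs_self c, abs_nonneg c, (Nat.cast_nonneg t : (0 : ℝ) ≤ t)]
      have h3 := (hlow.trans hmain).trans (mul_le_mul_of_nonneg_right hexp hM0)
      rw [Real.exp_neg, mul_inv_le_iff₀ (Real.exp_pos 1)] at h3
      rw [Real.exp_add]
      linarith)
  rwa [Finset.card_range] at this

/-- Two transverse axes force at least quadratic growth. -/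
theorem ContractingAxis.exists_sq_le_ncard_orbitBall [ProperSpace X]
    [ProperlyDiscontinuousSMul G X] {o : X} {h g : G} (A : ContractingAxis o h)
    (hg : g ∉ elementaryClosure h) :
    ∃ K : ℕ, ∀ n : ℕ, (n + 1) * (n + 1) ≤ (orbitBall G o (K * (n + 1))).ncard := by
  classical
  obtain ⟨K, hK⟩ := exists_nat_gt (2 * A.c + dist o (g • o))
  refine ⟨K, fun n => ?_⟩
  have hfin := finite_orbitBall (G := G) o (K * (n + 1))
  rw [Set.ncard_eq_toFinset_card _ hfin]
  have hcard : (Finset.range (n + 1) ×ˢ Finset.range (n + 1)).card = (n + 1) * (n + 1) := by simp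
  rw [← hcard]
  have hlen : ∀ i : ℕ, i ≤ n → dist o (h ^ (i : ℤ) • o) ≤ A.c * (n + 1) := by
    intro i hi
    have h1 := A.dist_le 0 i
    simp only [zpow_zero, one_smul, Int.cast_zero, zero_sub, abs_neg, Int.cast_natCast,
      Nat.abs_cast] at h1
    have : (i : ℝ) ≤ n := by exact_mod_cast hi
    nlinarith [A.c_pos]
  refine Finset.card_le_card_of_injOn (fun q => h ^ (q.1 : ℤ) * g * h ^ (q.2 : ℤ)) ?_ ?_
  · rintro ⟨i, j⟩ hij
    simp only [Finset.coe_product, Set.mem_prod, Finset.mem_coe, Finset.mem_range,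
      Nat.lt_succ_iff] at hij
    simp only [Finset.mem_coe, hfin.mem_toFinset]
    change dist o _ ≤ _
    have h1 := dist_smul_mul_le o (h ^ (i : ℤ) * g) (h ^ (j : ℤ))
    have h2 := dist_smul_mul_le o (h ^ (i : ℤ)) g
    have h3 : (0 : ℝ) ≤ n := Nat.cast_nonneg n
    push_cast
    nlinarith [hlen i hij.1, hlen j hij.2, dist_nonneg (x := o) (y := g • o)]
  · rintro ⟨i, j⟩ _ ⟨i', j'⟩ _ he
    simp only at he
    have he' : g * h ^ ((j : ℤ) - j') * g⁻¹ = h ^ ((i' : ℤ) - i) := by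
      have : g * h ^ (j : ℤ) = h ^ (-(i : ℤ)) * (h ^ (i' : ℤ) * g * h ^ (j' : ℤ)) := by
        rw [← he]; group
      rw [zpow_sub, ← mul_assoc, this]
      group
    by_cases hj : (j : ℤ) - j' = 0
    · rw [hj, zpow_zero, mul_one, mul_inv_cancel, ← zpow_zero h] at he'
      have := A.zpow_injective he'
      simp only [Prod.mk.injEq]
      omega
    · exact absurd (A.mem_elementaryClosure hj he') hg

theorem ContractingAxis.growthRate_pos [ProperSpace X]
    [ProperlyDiscontinuousSMul G X]
    (hX : IsGeodesicSpace X) {o : X} {h k g : G} (A : ContractingAxis o h)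
    (hg : g ∉ elementaryClosure h) {ε p : G → G} {R c : ℝ}
    (hε : ∀ v, ε v = 1 ∨ ε v = g)
    (hc : ∀ w v, dist o (concatenation k ε p w v • o) ≤ dist o (w • o) + dist o (v • o) + c)
    (hnear : ∀ w v γ L, 0 ≤ L → IsGeodesicOn γ L → γ 0 = o → γ L = concatenation k ε p w v • o →
      ∃ r ∈ Set.Icc 0 L, dist (γ r) (w • o) ≤ R) : 0 < growthRate G o := by
  by_contra hω
  obtain ⟨K, hK⟩ := exists_ncard_orbitBall_le_of_growthRate_nonpos hX hε hc hnear (not_lt.1 hω)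
  obtain ⟨M, hM⟩ := A.exists_sq_le_ncard_orbitBall hg
  -- At n = K(M + 1) the quadratic lower bound exceeds the linear upper bound.
  have h1 := (hM (K * (M + 1))).trans (hK _)
  have h2 : K * 1 ≤ K * (K * (M + 1) + 1) := Nat.mul_le_mul_left _ (Nat.le_add_left _ _)
  nlinarith

end Growth

/-! ### Shortest coset representatives. -/

section Quotient

variable {G X : Type*} [Group G] [MetricSpace X] [MulAction G X] [IsIsometricSMul G X]

/-- The elements of minimal length in their right coset of `H`. -/
def minimalElements (H : Subgroup G) (o : X) : Set G :=
  {w | ∀ η ∈ H, dist o (w • o) ≤ dist o ((η * w) • o)}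

/-- Inversion preserves length and turns left cosets into right cosets; properness makes the minimum
attained. -/
theorem quotientBall_subset_image [ProperSpace X] [ProperlyDiscontinuousSMul G X]
    (H : Subgroup G) (o : X) (n : ℕ) :
    quotientBall H o n ⊆ (fun w : G => (QuotientGroup.mk w⁻¹ : G ⧸ H)) ''
      (minimalElements H o ∩ orbitBall G o n) := by
  intro x hx
  obtain ⟨g, rfl⟩ := QuotientGroup.mk_surjective x
  obtain ⟨a, ha, hmin⟩ := Set.exists_min_image
    {a : G | (QuotientGroup.mk a : G ⧸ H) = QuotientGroup.mk g ∧ dist o (a • o) ≤ dist o (g • o)}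
    (fun a => dist o (a • o)) ((finite_setOf_dist_smul_le o (dist o (g • o))).subset
      fun a ha => ha.2) ⟨g, rfl, le_rfl⟩
  have hmin' : ∀ b : G, (QuotientGroup.mk b : G ⧸ H) = QuotientGroup.mk g →
      dist o (a • o) ≤ dist o (b • o) := by
    intro b hb
    by_cases h : dist o (b • o) ≤ dist o (g • o)
    · exact hmin b ⟨hb, h⟩
    · exact ha.2.trans (not_le.1 h).le
  refine ⟨a⁻¹, ⟨fun η hη => ?_, ?_⟩, by simpa using ha.1⟩
  · rw [dist_smul_inv, ← dist_smul_inv o (η * a⁻¹)]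
    refine hmin' _ ?_
    rw [← ha.1, mul_inv_rev, inv_inv]
    exact QuotientGroup.mk_mul_of_mem a (inv_mem hη)
  · change dist o (a⁻¹ • o) ≤ n
    rw [dist_smul_inv]
    refine le_trans ?_ (show Metric.infDist o _ ≤ (n : ℝ) from hx)
    have hne : ((fun g : G => g • o) '' {b : G | (QuotientGroup.mk b : G ⧸ H) =
        QuotientGroup.mk g}).Nonempty := ⟨_, Set.mem_image_of_mem _ (rfl : _ = _)⟩
    refine (Metric.le_infDist hne).2 fun y hy => ?_
    obtain ⟨b, hb, rfl⟩ := hy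
    exact hmin' b hb

/-- In a common concatenation, minimal elements have comparable lengths. -/
theorem dist_le_of_concatenation_eq (hX : IsGeodesicSpace X) {o : X} {H : Subgroup G} {k : G}
    {ε p : G → G} {R c : ℝ} (hε : ∀ v, dist o (ε v • o) ≤ R)
    (hH : ∀ w, (w * ε w⁻¹ * k) * p w * (w * ε w⁻¹ * k)⁻¹ ∈ H) (hk : 6 * R < dist o (k • o))
    (hc : ∀ w, dist o (concatPrefix k ε p w • o) ≤ dist o (w • o) + c)
    (hnear : ∀ w v γ L, 0 ≤ L → IsGeodesicOn γ L → γ 0 = o → γ L = concatenation k ε p w v • o →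
      (∃ r ∈ Set.Icc 0 L, dist (γ r) (w • o) ≤ R) ∧
        ∃ r ∈ Set.Icc 0 L, dist (γ r) (concatPrefix k ε p w • o) ≤ R)
    (hlen : ∀ w, dist o (w • o) + dist o (k • o) ≤ dist o (concatPrefix k ε p w • o) + R)
    {w₁ w₂ v₁ v₂ : G} (hw₂ : w₂ ∈ minimalElements H o)
    (he : concatenation k ε p w₁ v₁ = concatenation k ε p w₂ v₂) :
    dist o (w₂ • o) ≤ dist o (w₁ • o) + (c + 2 * R) := by
  by_contra! hlt
  set x := concatenation k ε p w₁ v₁ • o with hx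
  obtain ⟨γ, h0, h1, hγ⟩ := hX o x
  have hγ' : IsGeodesicOn γ (dist o x) := hγ
  obtain ⟨-, b, hb, hdb⟩ := hnear w₁ v₁ γ _ dist_nonneg hγ h0 h1
  obtain ⟨⟨a, ha, hda⟩, -⟩ := hnear w₂ v₂ γ _ dist_nonneg hγ h0 (by rw [h1, hx, he])
  have la := hγ'.dist_eq le_rfl ha.1 ha.2
  have lb := hγ'.dist_eq le_rfl hb.1 hb.2
  rw [h0, sub_zero] at la lb
  set m := concatPrefix k ε p w₁ with hm
  have h2 := dist_triangle_right o (γ a) (w₂ • o)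
  have h3 := dist_triangle o (γ a) (w₂ • o)
  have h4 := dist_triangle o (γ b) (m • o)
  have h5 := dist_triangle_right o (γ b) (m • o)
  have hab : b ≤ a := by linarith [hc w₁]
  have lab := hγ'.dist_eq hb.1 hab ha.2
  have h6 := dist_triangle4 (m • o) (γ b) (γ a) (w₂ • o)
  rw [dist_comm (m • o) (γ b), lab] at h6
  have h7 := hw₂ _ (inv_mem (hH w₁))
  -- With η the element of H from `hH w₁`, m = η w₁ε. Replacing the path to w₂ through m by one
  -- through w₁ε saves |k| up to an error of 6R, contradicting minimality of w₂.
  have h8 : ((w₁ * ε w₁⁻¹ * k) * p w₁ * (w₁ * ε w₁⁻¹ * k)⁻¹)⁻¹ * w₂ =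
      (w₁ * ε w₁⁻¹) * (m⁻¹ * w₂) := by
    rw [hm, concatPrefix]; group
  rw [h8] at h7
  have h9 := dist_smul_mul_le o (w₁ * ε w₁⁻¹) (m⁻¹ * w₂)
  have h10 := dist_smul_mul_le o w₁ (ε w₁⁻¹)
  rw [← dist_smul_smul] at h9
  linarith [hε w₁⁻¹, hlen w₁]

end Quotient

/-! ### Assembling the limit; virtually cyclic groups. -/

section Main

variable {G X : Type*} [Group G] [MetricSpace X] [ProperSpace X] [MulAction G X]
  [IsIsometricSMul G X] [ProperlyDiscontinuousSMul G X]

/-- Normalized quotient balls of a confined subgroup are negligible, for finite growth rate. -/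
theorem tendsto_ncard_quotientBall_mul_exp (hX : IsGeodesicSpace X) {o : X} {h g : G}
    (A : ContractingAxis o h) (hg : g ∉ elementaryClosure h) {H : Subgroup G} {P : Set G}
    (hconf : IsConfiningSubset H P) (hP : IsNondegenerate P) {ω : ℝ}
    (hω : growthRate G o = ω) :
    0 < ω ∧ Tendsto (fun n : ℕ => ((quotientBall H o n).ncard : ℝ) * Real.exp (-(n * ω))) atTop
      (𝓝 0) := by
  obtain ⟨x, hx⟩ := A.exists_forall_conj_notMem hX hconf.1 fun p hp =>
    A.exists_conj_notMem hX hg (Set.disjoint_left.1 hP hp)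
  have hQfin : ((fun p => x⁻¹ * p * x) '' P).Finite := hconf.1.image _
  have hQ : ∀ p ∈ (fun p => x⁻¹ * p * x) '' P, p ∉ elementaryClosure h := by
    rintro _ ⟨p, hp, rfl⟩
    exact hx p hp
  -- The conjugated set is still confining: use the original one at u x⁻¹.
  have hex : ∀ u : G, ∃ p ∈ (fun p => x⁻¹ * p * x) '' P, u * p * u⁻¹ ∈ H := by
    intro u
    obtain ⟨η, hη, hmem⟩ := hconf.2 (u * x⁻¹)
    refine ⟨_, ⟨_, hmem.1, rfl⟩, ?_⟩
    convert hη using 1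
    group
  obtain ⟨ε, R, hε, hεR, hcat⟩ := A.exists_concatenation hX hg hQfin hQ
  have hR0 : 0 ≤ R := dist_nonneg.trans (hεR 1)
  obtain ⟨N, -, hN⟩ := A.exists_lt_dist (6 * R)
  set k := h ^ (N : ℤ) with hk
  have hkR : 6 * R < dist o (k • o) := by
    have := hN 0 N (by simp)
    rwa [zpow_zero, one_smul] at this
  choose q hqQ hqH using hex
  set p : G → G := fun w => q (w * ε w⁻¹ * k) with hp
  have hpQ : ∀ w, p w ∈ (fun p => x⁻¹ * p * x) '' P := fun w => hqQ _
  obtain ⟨Q, hQb⟩ := (hQfin.image fun p => dist o (p • o)).bddAbove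
  have hpQ' : ∀ w, dist o (p w • o) ≤ Q := fun w => hQb ⟨p w, hpQ w, rfl⟩
  have hmain := hcat N (by linarith) p hpQ
  have hc := fun w v => dist_concatenation_le (k := k) hεR hpQ' w v
  have hnear : ∀ w v γ L, 0 ≤ L → IsGeodesicOn γ L → γ 0 = o →
      γ L = concatenation k ε p w v • o → ∃ r ∈ Set.Icc 0 L, dist (γ r) (w • o) ≤ R :=
    fun w v γ L hL hγ h0 h1 => ((hmain w).1 v γ L hL hγ h0 h1).1
  have hωpos : 0 < ω := by
    have := A.growthRate_pos hX hg hε (fun w v => (hc w v).2) hnear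
    rw [hω] at this
    exact_mod_cast this
  refine ⟨hωpos, ?_⟩
  have hW : ∀ w₁ ∈ minimalElements H o, ∀ w₂ ∈ minimalElements H o, ∀ v₁ v₂,
      concatenation k ε p w₁ v₁ = concatenation k ε p w₂ v₂ → dist o (w₂ • o) ≤ dist o (w₁ • o) +
        (R + 2 * dist o (k • o) + Q + 2 * R) := fun w₁ _ w₂ hw₂ v₁ v₂ he =>
    dist_le_of_concatenation_eq hX hεR (fun w => hqH _) hkR (fun w => (hc w 1).1)
      (fun w => (hmain w).1) (fun w => (hmain w).2) hw₂ he
  have hsum := fun (s : ℝ) (hs : 0 < s) (hlt : growthRate G o < s)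
    (F : Finset (minimalElements H o)) =>
    sum_exp_le_of_concatenation hX hε (fun w v => (hc w v).2) hnear hW hs hlt F
  have hlim := tendsto_ncard_inter_orbitBall_mul_exp (W := minimalElements H o) hωpos (fun F => by
    -- The bound holds for s > ω and both sides are continuous in s, so it persists at s = ω for
    -- each finite sum.
    refine ContinuousWithinAt.closure_le (s := Set.Ioi ω) (x := ω)
      (f := fun s => ∑ w ∈ F, Real.exp (-s * dist o ((w : G) • o)))
      (g := fun s => Real.exp (s * (2 * R + 2 * dist o (k • o) + Q)) *
        (2 * ({b : G | dist o (b • o) ≤ R + 2 * dist o (k • o) + Q + 2 * R + 4 * R}.ncard : ℝ))) (by simp)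
      (continuous_finsetSum F fun w _ => by fun_prop).continuousWithinAt (by fun_prop)
      fun s hs => ?_
    refine hsum s (hωpos.trans hs) ?_ F
    rw [hω]
    exact_mod_cast hs)
  refine squeeze_zero (fun n => by positivity) (fun n => ?_) hlim
  have hfin : (minimalElements H o ∩ orbitBall G o n).Finite :=
    (finite_orbitBall o n).subset Set.inter_subset_right
  gcongr
  exact (Set.ncard_le_ncard (quotientBall_subset_image H o n) (hfin.image _)).trans
    (Set.ncard_image_le hfin)

theorem isElementaryGroup_of_elementaryClosure_eq_top (hX : IsGeodesicSpace X) {o : X} {h : G}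
    (A : ContractingAxis o h) (htop : elementaryClosure h = ⊤) : IsElementaryGroup G := by
  refine Or.inr ⟨Subgroup.zpowers h, A.finiteIndex_zpowers hX htop, ⟨MulEquiv.symm ?_⟩⟩
  refine MulEquiv.ofBijective ((zpowersHom G h).codRestrict (Subgroup.zpowers h) fun n =>
    ⟨n.toAdd, rfl⟩) ⟨fun m n hmn => ?_, ?_⟩
  · exact Multiplicative.toAdd.injective (A.zpow_injective (congrArg Subtype.val hmn))
  · rintro ⟨_, n, rfl⟩
    exact ⟨Multiplicative.ofAdd n, rfl⟩

/-- A virtually cyclic group grows linearly, hence not purely exponentially. -/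
theorem not_hasPurelyExponentialGrowth (hX : IsGeodesicSpace X) {o : X} {h : G}
    (A : ContractingAxis o h) (htop : elementaryClosure h = ⊤) :
    ¬ HasPurelyExponentialGrowth G o := by
  classical
  rintro ⟨ω, -, C, hC1, hC⟩
  have hC0 : 0 < C := zero_lt_one.trans_le hC1
  -- For ω ≤ 0 the balls would have bounded size, but the powers of h are infinitely many.
  have hω : 0 < ω := by
    by_contra hω
    push Not at hω
    obtain ⟨K, hK⟩ := exists_nat_gt (2 * A.c)
    obtain ⟨n, hn⟩ := exists_nat_gt C
    have hfin := finite_orbitBall (G := G) o (K * (n + 1))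
    have hle : n + 1 ≤ (orbitBall G o (K * (n + 1))).ncard := by
      rw [Set.ncard_eq_toFinset_card _ hfin]
      refine (Finset.card_range (n + 1)).ge.trans ?_
      refine Finset.card_le_card_of_injOn (fun i : ℕ => h ^ (i : ℤ)) (fun i hi => ?_)
        fun i _ j _ hij => by exact_mod_cast A.zpow_injective hij
      simp only [Finset.coe_range, Set.mem_Iio, Nat.lt_succ_iff] at hi
      simp only [Finset.mem_coe, hfin.mem_toFinset]
      change dist o _ ≤ _
      have h1 := A.dist_le 0 i
      simp only [zpow_zero, one_smul, Int.cast_zero, zero_sub, abs_neg, Int.cast_natCast,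
        Nat.abs_cast] at h1
      have h2 : (i : ℝ) ≤ n := by exact_mod_cast hi
      push_cast
      nlinarith [A.c_pos, (Nat.cast_nonneg n : (0 : ℝ) ≤ n)]
    have h1 := (hC (K * (n + 1))).2
    have h2 : Real.exp (((K * (n + 1) : ℕ) : ℝ) * ω) ≤ 1 :=
      Real.exp_le_one_iff.2 (mul_nonpos_of_nonneg_of_nonpos (Nat.cast_nonneg _) hω)
    have h3 : (n : ℝ) + 1 ≤ ((orbitBall G o (K * (n + 1))).ncard : ℝ) := by exact_mod_cast hle
    nlinarith
  obtain ⟨B, hB, hrep⟩ := A.exists_finite_coset_reps hX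
  obtain ⟨K, hK⟩ := (hB.image fun b => dist o (b • o)).bddAbove
  have hcard : ∀ n : ℕ, ((orbitBall G o n).ncard : ℝ) ≤
      (2 * (A.c * (n + |K| + A.c)) + 1) * B.ncard := by
    intro n
    have hfin := finite_orbitBall (G := G) o n
    set J := ⌊A.c * (n + |K| + A.c)⌋₊ with hJ
    have hpos : 0 ≤ A.c * (n + |K| + A.c) := by
      have := A.c_pos
      positivity
    have hle : (orbitBall G o n).ncard ≤ (2 * J + 1) * B.ncard := by
      have hcI : (Finset.Icc (-(J : ℤ)) J).card = 2 * J + 1 := by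
        rw [Int.card_Icc]; omega
      rw [Set.ncard_eq_toFinset_card _ hfin, Set.ncard_eq_toFinset_card _ hB, ← hcI,
        ← Finset.card_product]
      refine (Finset.card_le_card (t := (Finset.Icc (-(J : ℤ)) J ×ˢ hB.toFinset).image
        fun q => h ^ q.1 * q.2) fun w hw => ?_).trans Finset.card_image_le
      rw [hfin.mem_toFinset] at hw
      obtain ⟨j, b, hb, rfl⟩ := hrep w (htop ▸ Subgroup.mem_top _)
      refine Finset.mem_image.2 ⟨(j, b), Finset.mem_product.2 ⟨?_, hB.mem_toFinset.2 hb⟩, rfl⟩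
      have hw' : dist o ((h ^ j * b) • o) ≤ n := hw
      have hbK : dist o (b • o) ≤ K := hK ⟨b, hb, rfl⟩
      have h1 := dist_smul_mul_le o (h ^ j * b) b⁻¹
      rw [dist_smul_inv, mul_inv_cancel_right] at h1
      have h2 := A.le_dist 0 j
      simp only [zpow_zero, one_smul, Int.cast_zero, zero_sub, abs_neg] at h2
      have h3 : |(j : ℝ)| / A.c ≤ n + |K| + A.c := by linarith [le_abs_self K]
      rw [div_le_iff₀ A.c_pos, mul_comm] at h3
      have h4 : j.natAbs ≤ J := by
        refine Nat.le_floor ?_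
        rwa [Nat.cast_natAbs, Int.cast_abs]
      rw [Finset.mem_Icc]
      omega
    calc ((orbitBall G o n).ncard : ℝ) ≤ ((2 * J + 1) * B.ncard : ℕ) := by exact_mod_cast hle
      _ = (2 * (J : ℝ) + 1) * B.ncard := by push_cast; ring
      _ ≤ _ := by gcongr; exact Nat.floor_le hpos
  obtain ⟨a, ha⟩ : ∃ a : ℝ, a = 2 * A.c * B.ncard * C := ⟨_, rfl⟩
  obtain ⟨b, hb⟩ : ∃ b : ℝ, b = (2 * (A.c * (|K| + A.c)) + 1) * B.ncard * C := ⟨_, rfl⟩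
  have hlin : ∀ n : ℕ, Real.exp (n * ω) ≤ a * n + b := by
    intro n
    have h1 := ((hC n).1).trans (hcard n)
    rw [inv_mul_le_iff₀ hC0] at h1
    rw [ha, hb]
    linarith
  have ha0 : 0 ≤ a := by
    have := A.c_pos
    rw [ha]; positivity
  have hb0 : 0 ≤ b := by
    have := A.c_pos
    rw [hb]; positivity
  -- Chosen so that (nω/2)², a lower bound for e^{nω}, exceeds an + b.
  obtain ⟨n, hn⟩ := exists_nat_gt (4 * (a + b) / ω ^ 2 + 1)
  have hn1 : (1 : ℝ) ≤ n := by
    have : 0 ≤ 4 * (a + b) / ω ^ 2 := by positivity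
    linarith
  have h1 : 4 * (a + b) < n * ω ^ 2 := by
    rw [← div_lt_iff₀ (by positivity)]; linarith
  have h2 : (n * ω / 2) ^ 2 ≤ Real.exp (n * ω) := by
    have : Real.exp (n * ω) = Real.exp (n * ω / 2) ^ 2 := by
      rw [← Real.exp_nat_mul]; congr 1; push_cast; ring
    rw [this]
    have := Real.add_one_le_exp (n * ω / 2)
    gcongr
    linarith
  have h3 := h2.trans (hlin n)
  have h4 : (n : ℝ) * (4 * (a + b)) < n * (n * ω ^ 2) := by gcongr
  nlinarith

end Main

theorem theorem1p6 {G X : Type*} [Group G] [MetricSpace X] [ProperSpace X] [MulAction G X]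
    [IsIsometricSMul G X] [ProperlyDiscontinuousSMul G X]
    (hX : IsGeodesicSpace X) (o : X)
    (hcontr : ∃ h : G, IsContractingElement o h)
    (H : Subgroup G) (P : Set G)
    (hconf : IsConfiningSubset H P) (hP : IsNondegenerate P) :
    (¬ IsElementaryGroup G →
      Tendsto (fun n : ℕ => ((quotientBall H o n).ncard : ℝ≥0∞) /
        EReal.exp ((n : EReal) * growthRate G o)) atTop (𝓝 0)) ∧
    (HasPurelyExponentialGrowth G o →
      Tendsto (fun n : ℕ => ((quotientBall H o n).ncard : ℝ) / ((orbitBall G o n).ncard : ℝ))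
        atTop (𝓝 0)) := by
  obtain ⟨h, hh⟩ := hcontr
  obtain ⟨A⟩ := hh.nonempty_contractingAxis
  constructor
  · intro hG
    obtain ⟨g, hg⟩ : ∃ g, g ∉ elementaryClosure h := by
      by_contra! hall
      exact hG (isElementaryGroup_of_elementaryClosure_eq_top hX A (eq_top_iff.2 fun g _ => hall g))
    have hnonneg : 0 ≤ growthRate G o := by
      refine le_limsup_of_frequently_le (Frequently.of_forall fun n => ?_)
      have : (1 : ℝ) ≤ (orbitBall G o n).ncard := by exact_mod_cast one_le_ncard_orbitBall o n
      exact_mod_cast div_nonneg (Real.log_nonneg this) (Nat.cast_nonneg n)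
    by_cases htop : growthRate G o = ⊤
    · refine tendsto_const_nhds.congr' ?_
      -- Positivity of n makes n · ⊤ = ⊤, so that the quotient vanishes.
      filter_upwards [eventually_gt_atTop 0] with n hn
      have hn' : (0 : EReal) < (n : EReal) := by exact_mod_cast hn
      rw [htop, EReal.mul_top_of_pos hn', EReal.exp_top, ENNReal.div_top]
    · obtain ⟨ω, hω⟩ : ∃ ω : ℝ, growthRate G o = ω :=
        ⟨_, (EReal.coe_toReal htop (ne_bot_of_gt (EReal.bot_lt_zero.trans_le hnonneg))).symm⟩
      obtain ⟨-, hlim⟩ := tendsto_ncard_quotientBall_mul_exp hX A hg hconf hP hω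
      have := ENNReal.tendsto_ofReal hlim
      rw [ENNReal.ofReal_zero] at this
      refine this.congr fun n => ?_
      have he : (n : EReal) * growthRate G o = ((n * ω : ℝ) : EReal) := by rw [hω]; norm_cast
      rw [he, EReal.exp_coe, ENNReal.ofReal_mul (Nat.cast_nonneg _), ENNReal.ofReal_natCast,
        Real.exp_neg, ENNReal.ofReal_inv_of_pos (Real.exp_pos _), div_eq_mul_inv]
  · intro hexp
    -- Here pure exponential growth itself rules out the virtually cyclic case.
    obtain ⟨g, hg⟩ : ∃ g, g ∉ elementaryClosure h := by
      by_contra! hall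
      exact not_hasPurelyExponentialGrowth hX A (eq_top_iff.2 fun g _ => hall g) hexp
    obtain ⟨ω, hω, C, hC1, hC⟩ := hexp
    obtain ⟨-, hlim⟩ := tendsto_ncard_quotientBall_mul_exp hX A hg hconf hP hω
    have hlim' := hlim.mul_const C
    rw [zero_mul] at hlim'
    refine squeeze_zero (fun n => by positivity) (fun n => ?_) hlim'
    have hC0 : 0 < C := zero_lt_one.trans_le hC1
    have h1 := (hC n).1
    calc ((quotientBall H o n).ncard : ℝ) / ((orbitBall G o n).ncard : ℝ)
        ≤ ((quotientBall H o n).ncard : ℝ) / (C⁻¹ * Real.exp (n * ω)) := by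
          gcongr
      _ = ((quotientBall H o n).ncard : ℝ) * Real.exp (-(n * ω)) * C := by
          rw [Real.exp_neg]
          field_simp
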